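/- Throughout, $\log$ is the base-2 logarithm. **Envelope class.** Let $f:\mathbb N_+\to(0,1]$ satisfy $1<\sum_{j\ge1}f(j)<\infty$, and let $\Lambda=\Lambda(f)$ be the set of laws of i.i.d. sequences $X_1,X_2,\dots$ of positive integers with $\mathbb P\{X_1=j\}\le f(j)$ for all $j$. The envelope distribution is $F(k)=1-\sum_{j>k}f(j)$ for $k\in\mathbb N$ when that sum is $<1$, and $F(k)=0$ otherwise. A smoothed envelope distribution, again written $F$, is a cumulative distribution function on $[0,\infty)$ that agrees with it on $\mathbb N$ and has a continuous derivative on $[0,\infty)$, positive at every $x$ with $F(\lfloor x\rfloor)\in(0,1)$. Write $\overline F=1-F$. **Domain of attraction.** With $U(t)=F^{-1}(1-1/t)$, we say $F\in\mathrm{MDA}(\gamma)$ if there are $A_n>0$ such that $F(A_nx+U(n))^n\to\exp(-(1+\gamma x)^{-1/\gamma})$ for all $x$ with $1+\gamma x>0$ (for $\gamma=0$ the limit is $\exp(-e^{-x})$). **Exact threshold.** For $t>0$ let $m(t)$ be the unique solution $x$ of $\overline F(x)=x/t$, and let $m_n=m(n)$. **Elias string of the ETAC code.** For a message $x_1,\dots,x_n$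 of positive integers let $x_{1,i}\ge\dots\ge x_{i,i}$ be the non-increasing rearrangement of $x_1,\dots,x_i$, and let $M_i=\min(\{i\}\cup\{1\le k\le i: x_{k,i}\le k\})$. For $2\le i\le n$ the symbol $x_i$ is redacted if $x_i>M_{i-1}$; the first symbol is never redacted. Then $C_{\mathrm E}$ is the concatenation of the Elias codewords of $x_i-M_{i-1}+1$ over the redacted symbols $x_i$, in order, followed by the Elias codeword of $1$ (the termination signal). The Elias codeword of an integer $y\ge1$ is a self-delimited binary string of $2\ell(\ell(y))+\ell(y)$ bits, where $\ell(z)=\lfloor\log\max(z,1)\rfloor+1$. We write $\ell(C_{\mathrm E})$ for the number of bits of $C_{\mathrm E}$, and $\mathbb E$ for the expectation when the message is $X_1,\dots,X_n$. **Lemma (Elias codelength).** Let $F$ be a smoothed envelope distribution for $f$ with $F\in\mathrm{MDA}(\gamma)$, $\gamma\ge0$. Then, as $n\to\infty$, for all sources in $\Lambda$, 1. $\displaystyle \mathbb E[\ell(C_{\mathrm E})]\le(2+o_\Lambda(1))\sum_{i=1}^n\frac1i\,m_i\log m_i$; 2. $\displaystyle \mathbb E[\ell(C_{\mathrm E})]\le(2+o_\Lambda(1))\int_1^n\frac1t\,m(t)\log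 m(t)\,dt$; 3. $\displaystyle \mathbb E[\ell(C_{\mathrm E})]\le(2+o_\Lambda(1))\,m_n\log n\,\log m_n$; 4. if $\gamma>0$, then $\displaystyle \mathbb E[\ell(C_{\mathrm E})]\le(2+o_\Lambda(1))\,m_n\log n$. Here $o_\Lambda(1)$ denotes a sequence that tends to $0$ and depends on $f$ and $F$ but not on the source in $\Lambda$; the bounds hold for all $n\ge n_0$, where $n_0$ likewise does not depend on the source. -/

import Mathlib

open Set Filter Topology MeasureTheory
open scoped ENNReal

namespace ETAC

noncomputable section

/-! ### Envelopes and envelope classes -/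

/-- An envelope function: a map `f : ℕ₊ → (0,1]` with `1 < ∑ f(j) < ∞`. -/
structure IsEnvelope (f : ℕ+ → ℝ) : Prop where
  pos : ∀ j, 0 < f j
  le_one : ∀ j, f j ≤ 1
  summable : Summable f
  one_lt_tsum : 1 < ∑' j, f j

/-- The alphabet `ℕ₊` carries the σ-algebra of all its subsets. -/
instance instMeasurableSpaceAlphabet : MeasurableSpace ℕ+ := ⊤

instance instDiscreteAlphabet : DiscreteMeasurableSpace ℕ+ := ⟨fun _ => trivial⟩

/-- The envelope class `Λ(f)`: the stationary memoryless sources (laws of i.i.d. sequences of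
positive integers) whose first marginal is dominated by `f`. -/
def envelopeClass (f : ℕ+ → ℝ) : Set (Measure (ℕ → ℕ+)) :=
  {P | ∃ (P₁ : Measure ℕ+) (_ : IsProbabilityMeasure P₁),
    (∀ j, P₁ {j} ≤ ENNReal.ofReal (f j)) ∧ P = Measure.infinitePi (fun _ : ℕ => P₁)}

/-- The tail sum `∑_{j > k} f(j)`. -/
def envelopeTail (f : ℕ+ → ℝ) (k : ℕ) : ℝ :=
  ∑' j : ℕ+, if k < (j : ℕ) then f j else 0

/-- The envelope distribution: `F(k) = 1 - ∑_{j > k} f(j)` where this sum is below `1`, and `0`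
otherwise. -/
def envelopeDist (f : ℕ+ → ℝ) (k : ℕ) : ℝ :=
  if envelopeTail f k < 1 then 1 - envelopeTail f k else 0

/-- `F` is a smoothed envelope distribution for `f`: a cumulative distribution function on
`[0,∞)` that coincides with the envelope distribution on `ℕ` and has a continuous derivative
on `[0,∞)`, positive at every `x` for which the envelope distribution at `⌊x⌋` is in `(0,1)`. -/
structure IsSmoothedEnvelope (f : ℕ+ → ℝ) (F : ℝ → ℝ) : Prop where
  mono : Monotone F
  eq_zero_of_neg : ∀ x, x < 0 → F x = 0
  tendsto_one : Tendsto F atTop (𝓝 1)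
  eq_envelopeDist : ∀ k : ℕ, F k = envelopeDist f k
  contDiffOn : ContDiffOn ℝ 1 F (Ici 0)
  deriv_pos : ∀ x, 0 ≤ x → envelopeDist f ⌊x⌋₊ ∈ Ioo (0 : ℝ) 1 →
    0 < derivWithin F (Ici 0) x

/-! ### Maximum domains of attraction -/

/-- The quantile function `U(t) = F⁻¹(1 - 1/t)`, with the (generalized) inverse of a distribution
function. -/
def quantile (F : ℝ → ℝ) (t : ℝ) : ℝ := sInf {x | 1 - 1 / t ≤ F x}

/-- The generalized extreme value distribution function, for `x` with `1 + γ x > 0`. -/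
def gev (γ x : ℝ) : ℝ :=
  if γ = 0 then Real.exp (-Real.exp (-x)) else Real.exp (-(1 + γ * x) ^ (-1 / γ))

/-- `F ∈ MDA(γ)`. -/
def InMDA (F : ℝ → ℝ) (γ : ℝ) : Prop :=
  ∃ A : ℕ → ℝ, (∀ n, 0 < A n) ∧ ∀ x, 0 < 1 + γ * x →
    Tendsto (fun n : ℕ => F (A n * x + quantile F n) ^ n) atTop (𝓝 (gev γ x))

/-! ### The exact threshold -/

/-- The exact threshold `m(t)`: the solution `x` of `1 - F(x) = x / t`. For `t > 0` the set below
is a singleton (see `existsUnique_threshold`), and `m(t)` is its element. -/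
def exactThreshold (F : ℝ → ℝ) (t : ℝ) : ℝ := sInf {x | 1 - F x = x / t}

theorem IsEnvelope.envelopeDist_zero {f : ℕ+ → ℝ} (hf : IsEnvelope f) :
    envelopeDist f 0 = 0 := by
  have h : envelopeTail f 0 = ∑' j, f j := by
    unfold envelopeTail
    exact tsum_congr fun j => by simp [j.pos]
  unfold envelopeDist
  rw [h, if_neg (not_lt.2 hf.one_lt_tsum.le)]

theorem existsUnique_threshold {f : ℕ+ → ℝ} {F : ℝ → ℝ} (hf : IsEnvelope f)
    (hF : IsSmoothedEnvelope f F) {t : ℝ} (ht : 0 < t) : ∃! x, 1 - F x = x / t := by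
  have h0 : F 0 = 0 := by
    have := hF.eq_envelopeDist 0
    rw [hf.envelopeDist_zero] at this
    simpa using this
  have hnn : ∀ x, 0 ≤ x → 0 ≤ F x := fun x hx => h0 ▸ hF.mono hx
  have hc : ContinuousOn (fun x => x / t - (1 - F x)) (Icc 0 t) := by
    have h1 : ContinuousOn F (Icc 0 t) :=
      hF.contDiffOn.continuousOn.mono fun x hx => hx.1
    exact (continuousOn_id.div_const t).sub (continuousOn_const.sub h1)
  have hmem : (0 : ℝ) ∈ Icc ((0 : ℝ) / t - (1 - F 0)) (t / t - (1 - F t)) := by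
    rw [h0, div_self ht.ne']
    constructor
    · simp
    · linarith [hnn t ht.le]
  obtain ⟨x, -, hx⟩ := intermediate_value_Icc ht.le hc hmem
  refine ⟨x, by simp only at hx ⊢; linarith, fun y hy => ?_⟩
  have hx' : 1 - F x = x / t := by simp only at hx; linarith
  simp only at hy
  rcases lt_trichotomy y x with h | h | h
  · have := hF.mono h.le
    have := div_lt_div_of_pos_right h ht
    linarith
  · exact h
  · have := hF.mono h.le
    have := div_lt_div_of_pos_right h ht
    linarith

theorem exactThreshold_spec {f : ℕ+ → ℝ} {F : ℝ → ℝ} (hf : IsEnvelope f)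
    (hF : IsSmoothedEnvelope f F) {t : ℝ} (ht : 0 < t) :
    1 - F (exactThreshold F t) = exactThreshold F t / t := by
  obtain ⟨x, hx, hu⟩ := existsUnique_threshold hf hF ht
  have : {x | 1 - F x = x / t} = {x} := by
    ext y
    exact ⟨fun hy => hu y hy, fun hy => by rw [mem_singleton_iff.1 hy]; exact hx⟩
  rw [exactThreshold, this, csInf_singleton]
  exact hx

/-! ### The Elias part of the ETAC code

An infinite message is a map `x : ℕ → ℕ₊`; its symbol number `i` is `x (i - 1)`, and its first
`i` symbols are `x 0, …, x (i - 1)`. -/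

/-- The order statistic `x_{k,i}`: the `k`-th largest among the first `i` symbols, with
multiplicity, for `1 ≤ k ≤ i`. -/
def orderStat (x : ℕ → ℕ+) (k i : ℕ) : ℕ :=
  (((Multiset.range i).map fun j => (x j : ℕ)).sort (· ≥ ·)).getD (k - 1) 0

/-- The empirical threshold `M_i`: the minimum of `i` and of the ranks `k` with `x_{k,i} ≤ k`. -/
def empThreshold (x : ℕ → ℕ+) (i : ℕ) : ℕ :=
  sInf (insert i {k | 1 ≤ k ∧ k ≤ i ∧ orderStat x k i ≤ k})

/-- Symbol number `i + 1` is redacted if it exceeds `M_i`; the first symbol never is. -/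
def IsRedacted (x : ℕ → ℕ+) (i : ℕ) : Prop := 1 ≤ i ∧ empThreshold x i < (x i : ℕ)

/-- `ℓ(z) = ⌊log₂ (max(z,1))⌋ + 1`, the length of the binary expansion of `z`. -/
def binLength (z : ℕ) : ℕ := Nat.log 2 (max z 1) + 1

/-- A self-delimited Elias codeword of `y ≥ 1`: the length of the binary expansion of `ℓ(y)` in
unary, then `ℓ(y)` and `y` in binary, most significant bit first. -/
def eliasEncode (y : ℕ) : List Bool :=
  List.replicate (binLength (binLength y)) false ++ (Nat.bits (binLength y)).reverse ++
    (Nat.bits y).reverse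

theorem length_bits {y : ℕ} (hy : 1 ≤ y) : (Nat.bits y).length = binLength y := by
  rw [binLength, max_eq_left hy, Nat.size_eq_bits_len]
  refine le_antisymm ?_ ?_
  · exact Nat.size_le.2 (Nat.lt_pow_succ_log_self (by norm_num) y)
  · exact Nat.lt_size.2 (Nat.pow_log_le_self 2 (by omega))

/-- The codeword of `y` has `2 ℓ(ℓ(y)) + ℓ(y)` bits. -/
theorem length_eliasEncode {y : ℕ} (hy : 1 ≤ y) :
    (eliasEncode y).length = 2 * binLength (binLength y) + binLength y := by
  have h : 1 ≤ binLength y := by unfold binLength; omega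
  simp only [eliasEncode, List.length_append, List.length_replicate, List.length_reverse,
    length_bits hy, length_bits h]
  ring

open Classical in
/-- The Elias string `C_E` of the ETAC code for the message formed by the first `n` symbols of
`x`: the codewords of the excesses `x_{i+1} - M_i + 1` of the redacted symbols, followed by the
codeword of `1`, which is produced by the termination symbol. -/
def eliasString (n : ℕ) (x : ℕ → ℕ+) : List Bool :=
  (((List.range n).filter fun i => IsRedacted x i).flatMap fun i =>
    eliasEncode ((x i : ℕ) - empThreshold x i + 1)) ++ eliasEncode 1

/-- The expected length `E[ℓ(C_E)]` under the source `P`, with values in `[0,∞]`. -/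
def expEliasLength (P : Measure (ℕ → ℕ+)) (n : ℕ) : ℝ≥0∞ :=
  ∫⁻ x, ((eliasString n x).length : ℝ≥0∞) ∂P

/-- `E[ℓ(C_E)] ≤ (2 + o(1)) b(n)` over the class `Λ(f)`, where the `o(1)` term is the same for all
sources of the class. -/
def EliasBound (f : ℕ+ → ℝ) (b : ℕ → ℝ) : Prop :=
  ∃ δ : ℕ → ℝ, Tendsto δ atTop (𝓝 0) ∧ ∀ᶠ n in atTop, ∀ P ∈ envelopeClass f,
    expEliasLength P n ≤ ENNReal.ofReal ((2 + δ n) * b n)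

end

end ETAC

/-! Write `m` for the exact threshold and `U` for the quantile function. Since the symbols are
i.i.d., symbol `i + 1` is exchangeable with each of the first `i`, so its redaction probability is
the expected fraction of the `i + 1` symbols that would be redacted if swapped into last place.
Deterministically, at most `M_i + 1` of them would be. Moreover `M_i` is at most `K` plus the number
of symbols exceeding `K`; with `K = ⌈m_i⌉` the envelope bounds the mean of the latter by `i (1 -
F(m_i)) = m_i`. The redaction probability is thus at most `(2 m_i + 2) / (i + 1)`, which is the
source of the factor 2.

A redacted symbol costs about its logarithm. Cut at `B = 2 ^ r ⌈m_i⌉`: symbols up to `B` cost at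
most `(1 + η) log m_i` bits for any `η > 0`, and larger symbols are charged in full under the
envelope. Membership in a domain of attraction with `γ ≥ 0` gives `1 - F(2y) ≤ c (1 - F(y))` for
some `c < 1` and all large `y`. A dyadic summation then makes the excess `O(c ^ r (m_i / i) log
m_i)`, negligible for large `r`. Every bound uses only the envelope, hence is uniform over the
class. Summation over `i` gives the first bound; comparing the sum with an integral and with the
harmonic series gives the second and third.

For `γ > 0` the tail has matching power bounds with exponents arbitrarily close to `1/γ`. One side
makes `log m(t)` at most about `log t / (1 + 1/γ)`; the other makes `∫₁ⁿ m(t)/t dt` at most about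
`(1 + 1/γ) m_n`. The factors cancel, and the fourth bound follows from the second. -/

namespace ETAC

/-! ### Smoothed envelopes, exact thresholds and quantiles. -/

section Envelope

variable {f : ℕ+ → ℝ} {F : ℝ → ℝ}

theorem IsSmoothedEnvelope.zero (hf : IsEnvelope f) (hF : IsSmoothedEnvelope f F) : F 0 = 0 := by
  have := hF.eq_envelopeDist 0
  rw [hf.envelopeDist_zero] at this
  simpa using this

theorem IsSmoothedEnvelope.nonneg (hf : IsEnvelope f) (hF : IsSmoothedEnvelope f F) (x : ℝ) :
    0 ≤ F x := by
  rcases lt_or_ge x 0 with h | h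
  · exact (hF.eq_zero_of_neg x h).ge
  · exact hF.zero hf ▸ hF.mono h

theorem IsEnvelope.summable_tail (hf : IsEnvelope f) (k : ℕ) :
    Summable fun j : ℕ+ => if k < (j : ℕ) then f j else 0 := by
  refine hf.summable.of_nonneg_of_le (fun j => ?_) fun j => ?_
  · split_ifs
    exacts [(hf.pos j).le, le_rfl]
  · split_ifs
    exacts [le_rfl, (hf.pos j).le]

theorem IsEnvelope.envelopeTail_pos (hf : IsEnvelope f) (k : ℕ) : 0 < envelopeTail f k := by
  refine (hf.summable_tail k).tsum_pos (fun j => ?_) ⟨k + 1, k.succ_pos⟩ ?_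
  · split_ifs
    exacts [(hf.pos j).le, le_rfl]
  · simpa using hf.pos _

theorem IsSmoothedEnvelope.lt_one (hf : IsEnvelope f) (hF : IsSmoothedEnvelope f F) (x : ℝ) :
    F x < 1 := by
  obtain ⟨k, hk⟩ := exists_nat_ge x
  refine (hF.mono hk).trans_lt ?_
  rw [hF.eq_envelopeDist, envelopeDist]
  have := hf.envelopeTail_pos k
  split_ifs <;> linarith

theorem IsSmoothedEnvelope.continuous (hf : IsEnvelope f) (hF : IsSmoothedEnvelope f F) :
    Continuous F := by
  have h : F = fun x => F (max x 0) := by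
    funext x
    rcases lt_or_ge x 0 with h | h
    · rw [max_eq_right h.le, hF.eq_zero_of_neg x h, hF.zero hf]
    · rw [max_eq_left h]
  rw [h]
  exact hF.contDiffOn.continuousOn.comp_continuous (continuous_id.max continuous_const)
    fun x => mem_Ici.2 (le_max_right _ _)

/-- For large `k` the complementary distribution function is the tail sum of the envelope. -/
theorem IsSmoothedEnvelope.eventually_envelopeTail (hF : IsSmoothedEnvelope f F) :
    ∀ᶠ k : ℕ in atTop, envelopeTail f k = 1 - F k := by
  have h := (hF.tendsto_one.comp tendsto_natCast_atTop_atTop).eventually (lt_mem_nhds one_pos)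
  filter_upwards [h] with k hk
  simp only [Function.comp_apply] at hk
  rw [hF.eq_envelopeDist, envelopeDist] at *
  split_ifs at * <;> linarith

theorem IsSmoothedEnvelope.min_envelopeTail_le (hF : IsSmoothedEnvelope f F) (k : ℕ) :
    min 1 (envelopeTail f k) ≤ 1 - F k := by
  rw [hF.eq_envelopeDist, envelopeDist]
  split_ifs
  · rw [min_le_iff]; right; linarith
  · simp

/-- The function `x / t - (1 - F x)` is strictly increasing and vanishes at the threshold. Lower
bounds on thresholds are obtained through this criterion. -/
theorem le_exactThreshold_iff (hf : IsEnvelope f) (hF : IsSmoothedEnvelope f F) {t : ℝ}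
    (ht : 0 < t) {x : ℝ} : x ≤ exactThreshold F t ↔ x / t ≤ 1 - F x := by
  have h := exactThreshold_spec hf hF ht
  constructor
  · intro hx
    have := hF.mono hx
    have := div_le_div_of_nonneg_right hx ht.le
    linarith
  · intro hx
    by_contra! hlt
    have := hF.mono hlt.le
    have := div_lt_div_of_pos_right hlt ht
    linarith

theorem exactThreshold_pos (hf : IsEnvelope f) (hF : IsSmoothedEnvelope f F) {t : ℝ}
    (ht : 0 < t) : 0 < exactThreshold F t := by
  have h := exactThreshold_spec hf hF ht
  have h1 := hF.lt_one hf (exactThreshold F t)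
  have h2 : 0 < exactThreshold F t / t := by linarith
  exact (div_pos_iff_of_pos_right ht).1 h2

theorem exactThreshold_le_self (hf : IsEnvelope f) (hF : IsSmoothedEnvelope f F) {t : ℝ}
    (ht : 0 < t) : exactThreshold F t ≤ t := by
  have h := exactThreshold_spec hf hF ht
  have h1 := hF.nonneg hf (exactThreshold F t)
  rw [← div_le_one ht]
  linarith

theorem exactThreshold_mono (hf : IsEnvelope f) (hF : IsSmoothedEnvelope f F) {s t : ℝ}
    (hs : 0 < s) (hst : s ≤ t) : exactThreshold F s ≤ exactThreshold F t := by
  rw [le_exactThreshold_iff hf hF (hs.trans_le hst), exactThreshold_spec hf hF hs]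
  exact div_le_div_of_nonneg_left (exactThreshold_pos hf hF hs).le hs hst

/-- The ratio `m(t) / t` equals `1 - F (m(t))`, and `m` is nondecreasing. -/
theorem exactThreshold_div_anti (hf : IsEnvelope f) (hF : IsSmoothedEnvelope f F) {s t : ℝ}
    (hs : 0 < s) (hst : s ≤ t) : exactThreshold F t / t ≤ exactThreshold F s / s := by
  rw [← exactThreshold_spec hf hF hs, ← exactThreshold_spec hf hF (hs.trans_le hst)]
  linarith [hF.mono (exactThreshold_mono hf hF hs hst)]

theorem continuousOn_exactThreshold (hf : IsEnvelope f) (hF : IsSmoothedEnvelope f F) :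
    ContinuousOn (exactThreshold F) (Ioi 0) := by
  -- Since `m(t) / t` is nonincreasing and `m(s) ≤ s`, the threshold is 1-Lipschitz.
  have key : ∀ s t : ℝ, 0 < s → s ≤ t →
      exactThreshold F t - exactThreshold F s ≤ t - s := by
    intro s t hs hst
    have ht := hs.trans_le hst
    have h1 := exactThreshold_div_anti hf hF hs hst
    rw [div_le_div_iff₀ ht hs] at h1
    have h2 := exactThreshold_le_self hf hF hs
    nlinarith
  refine LipschitzOnWith.continuousOn (K := 1) (LipschitzOnWith.of_dist_le_mul fun s hs t ht => ?_)
  simp only [NNReal.coe_one, one_mul, Real.dist_eq]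
  rcases le_total s t with h | h
  · rw [abs_sub_comm, abs_sub_comm s, abs_of_nonneg (sub_nonneg.2 h),
      abs_of_nonneg (sub_nonneg.2 (exactThreshold_mono hf hF hs h))]
    exact key s t hs h
  · rw [abs_of_nonneg (sub_nonneg.2 h),
      abs_of_nonneg (sub_nonneg.2 (exactThreshold_mono hf hF ht h))]
    exact key t s ht h

theorem tendsto_exactThreshold (hf : IsEnvelope f) (hF : IsSmoothedEnvelope f F) :
    Tendsto (exactThreshold F) atTop atTop := by
  refine tendsto_atTop.2 fun b => ?_
  have hb : 0 < 1 - F b := sub_pos.2 (hF.lt_one hf b)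
  filter_upwards [eventually_gt_atTop 0, eventually_ge_atTop (b / (1 - F b))] with t ht h
  rw [le_exactThreshold_iff hf hF ht, div_le_iff₀ ht]
  rw [div_le_iff₀ hb] at h
  linarith

theorem tendsto_compl (hF : IsSmoothedEnvelope f F) : Tendsto (fun x => 1 - F x) atTop (𝓝 0) := by
  simpa using hF.tendsto_one.const_sub 1

/-- The quantile of order `1 - 1 / t` is attained. -/
theorem compl_quantile (hf : IsEnvelope f) (hF : IsSmoothedEnvelope f F) {t : ℝ} (ht : 1 ≤ t) :
    1 - F (quantile F t) = 1 / t := by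
  have hc := hF.continuous hf
  rcases ht.eq_or_lt with rfl | ht
  -- At `t = 1` the set is the whole line, and its `sInf` takes the default value 0, where `F`
  -- vanishes as required.
  · have : {x | 1 - 1 / 1 ≤ F x} = univ := by
      ext x
      simpa using hF.nonneg hf x
    rw [quantile, this, Real.sInf_univ, hF.zero hf]
    norm_num
  have hp : 0 < 1 - 1 / t := by
    rw [sub_pos, div_lt_one (by linarith)]; exact ht
  have hlt : 1 - 1 / t < 1 := by
    have : 0 < 1 / t := by positivity
    linarith
  obtain ⟨b, hb⟩ := (hF.tendsto_one.eventually (lt_mem_nhds hlt)).exists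
  have hS0 : ∀ x, 1 - 1 / t ≤ F x → 0 ≤ x := by
    intro x hx
    by_contra! h
    rw [hF.eq_zero_of_neg x h] at hx
    linarith
  have hbdd : BddBelow {x | 1 - 1 / t ≤ F x} := ⟨0, fun x hx => hS0 x hx⟩
  have hmem : quantile F t ∈ {x | 1 - 1 / t ≤ F x} :=
    (isClosed_le continuous_const hc).csInf_mem ⟨b, hb.le⟩ hbdd
  have hb0 : (0 : ℝ) ≤ b := hS0 b hb.le
  obtain ⟨y, -, hy⟩ := intermediate_value_Icc hb0 hc.continuousOn
    (show 1 - 1 / t ∈ Icc (F 0) (F b) from ⟨by rw [hF.zero hf]; exact hp.le, hb.le⟩)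
  have h1 : quantile F t ≤ y := csInf_le hbdd hy.ge
  have h2 := hF.mono h1
  rw [hy] at h2
  have h3 : 1 - 1 / t ≤ F (quantile F t) := hmem
  linarith

theorem tendsto_quantile (hf : IsEnvelope f) (hF : IsSmoothedEnvelope f F) :
    Tendsto (quantile F) atTop atTop := by
  refine tendsto_atTop.2 fun b => ?_
  have hb : 0 < 1 - F b := sub_pos.2 (hF.lt_one hf b)
  filter_upwards [eventually_ge_atTop 1, eventually_gt_atTop (1 / (1 - F b))] with t ht h
  by_contra! hlt
  have h1 := compl_quantile hf hF ht
  have h2 := hF.mono hlt.le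
  rw [div_lt_iff₀ hb] at h
  have h3 : 1 - F b ≤ 1 / t := by linarith
  rw [le_div_iff₀ (by linarith)] at h3
  linarith

end Envelope

/-! ### Tail decay in a domain of attraction. -/

section DomainOfAttraction

variable {f : ℕ+ → ℝ} {F : ℝ → ℝ} {γ : ℝ} {A : ℕ → ℝ}

/-- Taking logarithms gives `n log u_n → -v`, hence `u_n → 1`; the inequalities `1 - 1/u ≤ log u ≤ u
- 1` then squeeze `n (1 - u_n)`. -/
theorem tendsto_mul_one_sub_of_tendsto_pow {u : ℕ → ℝ} (hu : ∀ n, 0 ≤ u n) {v : ℝ}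
    (h : Tendsto (fun n => u n ^ n) atTop (𝓝 (Real.exp (-v)))) :
    Tendsto (fun n : ℕ => n * (1 - u n)) atTop (𝓝 v) := by
  have hpos : ∀ᶠ n in atTop, 0 < u n := by
    filter_upwards [h.eventually (lt_mem_nhds (Real.exp_pos _)), eventually_ge_atTop 1]
      with n hn h1
    refine (hu n).lt_of_ne fun h0 => ?_
    rw [← h0, zero_pow (by omega)] at hn
    exact hn.false
  have hlog : Tendsto (fun n : ℕ => n * Real.log (u n)) atTop (𝓝 (-v)) := by
    have := h.log (Real.exp_pos _).ne'
    rw [Real.log_exp] at this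
    exact this.congr fun n => by rw [Real.log_pow]
  have hlog0 : Tendsto (fun n => Real.log (u n)) atTop (𝓝 0) := by
    have := hlog.mul (tendsto_inv_atTop_zero.comp (tendsto_natCast_atTop_atTop (R := ℝ)))
    rw [mul_zero] at this
    refine this.congr' ?_
    filter_upwards [eventually_ge_atTop 1] with n hn
    have : (n : ℝ) ≠ 0 := by positivity
    simp only [Function.comp_apply]
    field_simp
  have hone : Tendsto u atTop (𝓝 1) := by
    have := (Real.continuous_exp.tendsto 0).comp hlog0
    rw [Real.exp_zero] at this
    refine this.congr' ?_
    filter_upwards [hpos] with n hn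
    exact Real.exp_log hn
  have hlo : Tendsto (fun n : ℕ => u n * -(n * Real.log (u n))) atTop (𝓝 v) := by
    simpa using hone.mul hlog.neg
  have hhi : Tendsto (fun n : ℕ => -(n * Real.log (u n))) atTop (𝓝 v) := by
    simpa using hlog.neg
  refine tendsto_of_tendsto_of_tendsto_of_le_of_le' hlo hhi ?_ ?_
  · filter_upwards [hpos] with n hn
    have h1 : 1 - (u n)⁻¹ ≤ Real.log (u n) := Real.one_sub_inv_le_log_of_pos hn
    have h2 : u n * (1 - (u n)⁻¹) ≤ u n * Real.log (u n) := by gcongr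
    rw [mul_sub, mul_one, mul_inv_cancel₀ hn.ne'] at h2
    have h3 : (0 : ℝ) ≤ n := by positivity
    nlinarith
  · filter_upwards [hpos] with n hn
    have h1 := Real.log_le_sub_one_of_pos hn
    have h3 : (0 : ℝ) ≤ n := by positivity
    nlinarith

/-- The exponent of the generalized extreme value distribution. -/
noncomputable def gevRate (γ x : ℝ) : ℝ :=
  if γ = 0 then Real.exp (-x) else (1 + γ * x) ^ (-1 / γ)

theorem gev_eq_exp_neg_gevRate (γ x : ℝ) : gev γ x = Real.exp (-gevRate γ x) := by
  unfold gev gevRate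
  split_ifs <;> rfl

theorem gevRate_lt_one (hγ : 0 ≤ γ) {x : ℝ} (hx : 0 < x) : gevRate γ x < 1 := by
  unfold gevRate
  split_ifs with h
  · rw [Real.exp_lt_one_iff]; linarith
  · have hγ' : 0 < γ := hγ.lt_of_ne' h
    refine Real.rpow_lt_one_of_one_lt_of_neg (by nlinarith) ?_
    exact div_neg_of_neg_of_pos (by norm_num) hγ'

theorem gevRate_nonneg {x : ℝ} (hx : 0 < 1 + γ * x) : 0 ≤ gevRate γ x := by
  unfold gevRate
  split_ifs with h <;> positivity

variable (hf : IsEnvelope f) (hF : IsSmoothedEnvelope f F)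

section

variable (h : ∀ x, 0 < 1 + γ * x →
    Tendsto (fun n : ℕ => F (A n * x + quantile F n) ^ n) atTop (𝓝 (gev γ x)))

include hf hF h

theorem tendsto_mul_compl_of_mda {x : ℝ} (hx : 0 < 1 + γ * x) :
    Tendsto (fun n : ℕ => n * (1 - F (A n * x + quantile F n))) atTop (𝓝 (gevRate γ x)) := by
  refine tendsto_mul_one_sub_of_tendsto_pow (fun n => hF.nonneg hf _) ?_
  rw [← gev_eq_exp_neg_gevRate]
  exact h x hx

/-- Otherwise `U(n) - A n * d` is negative, so `F` vanishes there and `n (1 - F)` equals `n`,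
against its finite limit `gevRate γ (-d)`. -/
theorem eventually_mul_le_quantile_of_mda {d : ℝ} (hd : γ * d < 1) :
    ∀ᶠ n : ℕ in atTop, A n * d ≤ quantile F n := by
  have h1 := tendsto_mul_compl_of_mda hf hF h (x := -d) (by linarith)
  filter_upwards [h1.eventually (gt_mem_nhds (lt_add_one _)),
    tendsto_natCast_atTop_atTop.eventually (eventually_ge_atTop (gevRate γ (-d) + 1))] with n h2 h3
  by_contra! hlt
  rw [hF.eq_zero_of_neg _ (by linarith)] at h2
  linarith

end

include hf hF in
/-- The complementary distribution function at consecutive quantiles brackets its value at any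
large point. -/
theorem eventually_exists_quantile_bracket (N : ℕ) : ∀ᶠ y in atTop, ∃ n : ℕ, N ≤ n ∧ 1 ≤ n ∧
    quantile F n ≤ y ∧ y ≤ quantile F (n + 1 : ℕ) ∧ 1 / ((n : ℝ) + 1) ≤ 1 - F y ∧
    1 - F y ≤ 1 / n := by
  have h0 := (tendsto_compl hF).eventually (gt_mem_nhds (show (0 : ℝ) < 1 / (N + 1) by positivity))
  filter_upwards [h0, eventually_gt_atTop 0] with y hy hy0
  have hp : 0 < 1 - F y := sub_pos.2 (hF.lt_one hf y)
  have hex : ∃ n : ℕ, y < quantile F (n + 1 : ℕ) := by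
    have := ((tendsto_quantile hf hF).comp (tendsto_natCast_atTop_atTop)).comp
      (tendsto_add_atTop_nat 1)
    exact (this.eventually (eventually_gt_atTop y)).exists
  classical
  -- Minimality puts `y` between consecutive quantiles; the smallness of `1 - F y` forces `N < n`,
  -- so that minimality may be applied at `n - 1`.
  obtain ⟨n, hn, hmin⟩ : ∃ n, y < quantile F (n + 1 : ℕ) ∧
      ∀ k < n, ¬ y < quantile F (k + 1 : ℕ) :=
    ⟨Nat.find hex, Nat.find_spec hex, fun k hk => Nat.find_min hex hk⟩
  have hup : 1 / ((n : ℝ) + 1) ≤ 1 - F y := by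
    have h1 := compl_quantile hf hF (t := ((n + 1 : ℕ) : ℝ)) (by push_cast; linarith [n.cast_nonneg (α := ℝ)])
    have h2 := hF.mono hn.le
    push_cast at h1 h2
    linarith
  have hNn : N < n := by
    have h3 : 1 / ((n : ℝ) + 1) < 1 / (N + 1) := hup.trans_lt hy
    have h4 : (N : ℝ) + 1 < n + 1 := lt_of_one_div_lt_one_div (by positivity) h3
    exact_mod_cast (by linarith : (N : ℝ) < n)
  have hq : quantile F n ≤ y := by
    have := hmin (n - 1) (by omega)
    rw [show n - 1 + 1 = n by omega] at this
    exact not_lt.1 this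
  refine ⟨n, hNn.le, by omega, hq, hn.le, hup, ?_⟩
  have h1 := compl_quantile hf hF (t := (n : ℝ)) (by exact_mod_cast (by omega : 1 ≤ n))
  have h2 := hF.mono hq
  linarith

include hf hF in
-- An estimate at the points `U(n)` passes to every large `y` by bracketing `y` between consecutive
-- quantiles. This loses a factor `1 + 1/n`, absorbed in the gap between `c` and `c'`.
theorem eventually_compl_le_of_quantile {l c : ℝ} (hl : 0 ≤ l) (hc : 0 < c) {c' : ℝ} (hcc : c < c')
    (h : ∀ᶠ n : ℕ in atTop, n * (1 - F (l * quantile F n)) ≤ c) :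
    ∀ᶠ y in atTop, 1 - F (l * y) ≤ c' * (1 - F y) := by
  have h1 : Tendsto (fun n : ℕ => c * (1 + 1 / (n : ℝ))) atTop (𝓝 c) := by
    simpa using (tendsto_one_div_atTop_nhds_zero_nat.const_add (1 : ℝ)).const_mul c
  obtain ⟨N, hN⟩ := eventually_atTop.1 (h.and (h1.eventually (gt_mem_nhds hcc)))
  filter_upwards [eventually_exists_quantile_bracket hf hF N] with y ⟨n, hNn, hn1, hq, _, hlo, _⟩
  obtain ⟨ha, hb⟩ := hN n hNn
  have hn : (0 : ℝ) < n := by exact_mod_cast hn1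
  have h2 := hF.mono (mul_le_mul_of_nonneg_left hq hl)
  have h3 : 1 - F (l * y) ≤ c / n := by
    rw [le_div_iff₀ hn]
    nlinarith
  have h4 : c / n ≤ c' * (1 / (n + 1)) := by
    rw [mul_one_div, div_le_div_iff₀ hn (by linarith)]
    have : c * (1 + 1 / (n : ℝ)) * n = c * (n + 1) := by field_simp
    nlinarith
  have h5 : c' * (1 / ((n : ℝ) + 1)) ≤ c' * (1 - F y) := by gcongr; linarith
  linarith

include hf hF in
/-- In a domain of attraction with `γ ≥ 0` the tail decreases by a factor bounded away from `1` when
its argument is doubled. -/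
theorem InMDA.eventually_compl_two_mul_le (hγ : 0 ≤ γ) (hmda : InMDA F γ) :
    ∃ c : ℝ, 0 < c ∧ c < 1 ∧ ∀ᶠ y in atTop, 1 - F (2 * y) ≤ c * (1 - F y) := by
  obtain ⟨A, hA, h⟩ := hmda
  -- The choice ensures `γ d < 1`, so that `A n * d ≤ U(n)` eventually, and doubling `U(n)` moves at
  -- least to `U(n) + A n * d`.
  set d : ℝ := 1 / (2 * (γ + 1)) with hd
  have hd0 : 0 < d := by positivity
  have hgd : γ * d < 1 := by
    rw [hd, mul_one_div, div_lt_one (by positivity)]; linarith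
  have hp : 0 < 1 + γ * d := by positivity
  have h1 := gevRate_lt_one hγ hd0
  have h0 := gevRate_nonneg hp
  set r := gevRate γ d
  refine ⟨(r + 3) / 4, by linarith, by linarith,
    eventually_compl_le_of_quantile hf hF (c := (r + 1) / 2) (by norm_num) (by linarith)
      (by linarith) ?_⟩
  filter_upwards [(tendsto_mul_compl_of_mda hf hF h hp).eventually
    (gt_mem_nhds (show r < (r + 1) / 2 by linarith)),
    eventually_mul_le_quantile_of_mda hf hF h hgd] with n h2 h3
  have h4 := hF.mono (show A n * d + quantile F n ≤ 2 * quantile F n by linarith)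
  have : (0 : ℝ) ≤ n := by positivity
  nlinarith

end DomainOfAttraction

/-! ### Combinatorics of the empirical threshold. -/

section Threshold

/-- The number of symbols exceeding `k` among the first `i`. -/
def exceedCount (x : ℕ → ℕ+) (i k : ℕ) : ℕ := ((Finset.range i).filter fun j => k < (x j : ℕ)).card

theorem exceedCount_anti (x : ℕ → ℕ+) (i : ℕ) {k l : ℕ} (h : k ≤ l) :
    exceedCount x i l ≤ exceedCount x i k :=
  Finset.card_le_card (Finset.monotone_filter_right _ fun _ _ hj => h.trans_lt hj)

theorem exceedCount_le (x : ℕ → ℕ+) (i k : ℕ) : exceedCount x i k ≤ i :=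
  (Finset.card_filter_le _ _).trans_eq (Finset.card_range i)

/-- In a non-increasing list the entry of index `p` is at most `v` if and only if at most `p` entries
exceed `v`. -/
theorem getElem_le_iff_countP_le {l : List ℕ} (hl : l.Pairwise (· ≥ ·)) {p : ℕ}
    (hp : p < l.length) (v : ℕ) : l[p] ≤ v ↔ l.countP (v < ·) ≤ p := by
  have hmono : ∀ i j (hi : i < l.length) (hj : j < l.length), i ≤ j → l[j] ≤ l[i] := by
    intro i j hi hj hij
    rcases hij.eq_or_lt with rfl | hlt
    · exact le_rfl
    · exact List.pairwise_iff_getElem.1 hl i j hi hj hlt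
  constructor
  · intro h
    have h0 : (l.drop p).countP (v < ·) = 0 := by
      rw [List.countP_eq_zero]
      intro a ha
      obtain ⟨i, hi, rfl⟩ := List.getElem_of_mem ha
      rw [List.getElem_drop]
      have := hmono p (p + i) hp (by rw [List.length_drop] at hi; omega) (by omega)
      simp only [decide_eq_true_eq, not_lt]
      omega
    rw [← List.take_append_drop p l, List.countP_append, h0, add_zero]
    exact List.countP_le_length.trans (by simp)
  · intro h
    by_contra! hlt
    have h1 : (l.take (p + 1)).countP (v < ·) = p + 1 := by
      have : (l.take (p + 1)).length = p + 1 := by rw [List.length_take]; omega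
      refine (List.countP_eq_length.2 ?_).trans this
      intro a ha
      obtain ⟨i, hi, rfl⟩ := List.getElem_of_mem ha
      rw [List.getElem_take]
      have := hmono i p (by rw [List.length_take] at hi; omega) hp
        (by rw [List.length_take] at hi; omega)
      simp only [decide_eq_true_eq]
      omega
    rw [← List.take_append_drop (p + 1) l, List.countP_append, h1] at h
    omega

theorem orderStat_le_iff (x : ℕ → ℕ+) {k i : ℕ} (hk : 1 ≤ k) (hki : k ≤ i) (v : ℕ) :
    orderStat x k i ≤ v ↔ exceedCount x i v < k := by
  set s : Multiset ℕ := (Multiset.range i).map fun j => (x j : ℕ) with hs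
  have hlen : (s.sort (· ≥ ·)).length = i := by simp [hs]
  have hp : k - 1 < (s.sort (· ≥ ·)).length := by omega
  have hcount : (s.sort (· ≥ ·)).countP (v < ·) = exceedCount x i v := by
    rw [← Multiset.coe_countP, Multiset.sort_eq, hs, Multiset.countP_map, exceedCount]
    rfl
  rw [orderStat, List.getD_eq_getElem _ _ hp, getElem_le_iff_countP_le (Multiset.pairwise_sort _ _) hp,
    hcount]
  omega

theorem empThreshold_le_self (x : ℕ → ℕ+) (i : ℕ) : empThreshold x i ≤ i :=
  Nat.sInf_le (mem_insert _ _)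

theorem empThreshold_mem (x : ℕ → ℕ+) (i : ℕ) : empThreshold x i = i ∨
    (1 ≤ empThreshold x i ∧ empThreshold x i ≤ i ∧
      orderStat x (empThreshold x i) i ≤ empThreshold x i) :=
  Nat.sInf_mem (s := insert i {k | 1 ≤ k ∧ k ≤ i ∧ orderStat x k i ≤ k}) ⟨i, mem_insert _ _⟩

theorem one_le_empThreshold (x : ℕ → ℕ+) {i : ℕ} (hi : 1 ≤ i) : 1 ≤ empThreshold x i := by
  rcases empThreshold_mem x i with h | h
  · omega
  · exact h.1

theorem exceedCount_empThreshold_le (x : ℕ → ℕ+) (i : ℕ) :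
    exceedCount x i (empThreshold x i) ≤ empThreshold x i := by
  rcases empThreshold_mem x i with h | ⟨h1, h2, h3⟩
  · rw [h]; exact exceedCount_le _ _ _
  · exact ((orderStat_le_iff x h1 h2 _).1 h3).le

/-- The rank `k = K + exceedCount x i K` is admissible when `k ≤ i`: at most `exceedCount x i K < k`
symbols exceed `k`. If `k > i`, the cap `M_i ≤ i` suffices. -/
theorem empThreshold_le_add (x : ℕ → ℕ+) (i : ℕ) {K : ℕ} (hK : 1 ≤ K) :
    empThreshold x i ≤ K + exceedCount x i K := by
  rcases le_or_gt (K + exceedCount x i K) i with h | h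
  · refine Nat.sInf_le (mem_insert_of_mem _ ⟨by omega, h, ?_⟩)
    rw [orderStat_le_iff x (by omega) h]
    have := exceedCount_anti x i (Nat.le_add_right K (exceedCount x i K))
    omega
  · exact (empThreshold_le_self x i).trans h.le

theorem exceedCount_comp_perm (x : ℕ → ℕ+) (σ : Equiv.Perm ℕ) {i : ℕ}
    (hσ : ∀ j, σ j < i ↔ j < i) (k : ℕ) : exceedCount (x ∘ σ) i k = exceedCount x i k := by
  refine Finset.card_bij (fun j _ => σ j) (fun j hj => ?_) (fun _ _ _ _ h => σ.injective h)
    fun j hj => ⟨σ.symm j, ?_, σ.apply_symm_apply j⟩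
  · simpa [hσ] using hj
  · have := hσ (σ.symm j)
    rw [σ.apply_symm_apply] at this
    simpa [← this] using hj

theorem exceedCount_succ_le (x : ℕ → ℕ+) (i k : ℕ) :
    exceedCount x (i + 1) k ≤ exceedCount x i k + 1 := by
  unfold exceedCount
  rw [Finset.range_add_one, Finset.filter_insert]
  split_ifs
  · exact Finset.card_insert_le _ _
  · omega

/-- If each of the first `i + 1` symbols is moved in turn to the last position, then the number of
times it is redacted there is at most `M_i + 1`. -/
theorem card_filter_isRedacted_comp_swap_le (x : ℕ → ℕ+) (i : ℕ) :
    ((Finset.range (i + 1)).filter fun j =>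
      empThreshold (x ∘ Equiv.swap j i) i < (x j : ℕ)).card ≤ empThreshold x i + 1 := by
  -- Take the swap with the smallest resulting threshold. Every symbol counted exceeds this common
  -- level. The number of symbols above a level is unchanged by the swap, and in the swapped message
  -- it is at most the threshold plus one for the last symbol.
  obtain ⟨j₀, hj₀, hmin⟩ := Finset.exists_min_image (Finset.range (i + 1))
    (fun j => empThreshold (x ∘ Equiv.swap j i) i) ⟨i, by simp⟩
  set y := x ∘ Equiv.swap j₀ i with hy
  have h1 : ((Finset.range (i + 1)).filter fun j =>
      empThreshold (x ∘ Equiv.swap j i) i < (x j : ℕ)).card ≤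
      exceedCount x (i + 1) (empThreshold y i) := by
    refine Finset.card_le_card fun j hj => ?_
    rw [Finset.mem_filter] at hj ⊢
    exact ⟨hj.1, (hmin j hj.1).trans_lt hj.2⟩
  have h2 : exceedCount y (i + 1) (empThreshold y i) = exceedCount x (i + 1) (empThreshold y i) := by
    refine exceedCount_comp_perm x _ (fun j => ?_) _
    rw [Finset.mem_range] at hj₀
    rw [Equiv.swap_apply_def]
    split_ifs <;> omega
  have h3 := exceedCount_succ_le y i (empThreshold y i)
  have h4 := exceedCount_empThreshold_le y i
  have h5 := hmin i (by simp)
  rw [Equiv.swap_self] at h5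
  simp only [Equiv.coe_refl, Function.comp_id] at h5
  omega

end Threshold

/-! ### The length of the Elias string as a sum over symbols. -/

section EliasLength

/-- The length `2 ℓ(ℓ(y)) + ℓ(y)` of the Elias codeword of `y`. -/
def eliasLength (y : ℕ) : ℕ := 2 * binLength (binLength y) + binLength y

theorem binLength_mono : Monotone binLength := fun a b h => by
  unfold binLength
  gcongr

theorem eliasLength_mono : Monotone eliasLength := fun a b h => by
  have h1 := binLength_mono h
  have h2 := binLength_mono h1
  unfold eliasLength
  omega

open Classical in
/-- The contribution of the symbol of index `i` to the length of the Elias string. -/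
noncomputable def eliasTerm (x : ℕ → ℕ+) (i : ℕ) : ℕ :=
  if IsRedacted x i then eliasLength ((x i : ℕ) - empThreshold x i + 1) else 0

theorem length_eliasString (n : ℕ) (x : ℕ → ℕ+) :
    (eliasString n x).length = ∑ i ∈ Finset.range n, eliasTerm x i + 3 := by
  classical
  have h1 : (eliasEncode 1).length = 3 := by
    rw [length_eliasEncode le_rfl]
    norm_num [binLength]
  rw [eliasString, List.length_append, h1, add_left_inj]
  induction n with
  | zero => simp
  | succ n ih =>
    rw [List.range_succ, List.filter_append, List.flatMap_append, List.length_append, ih,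
      Finset.sum_range_succ, add_right_inj]
    by_cases h : IsRedacted x n
    · simp only [eliasTerm, h, List.filter_cons, decide_true, if_true, List.filter_nil,
        List.flatMap_cons, List.flatMap_nil, List.append_nil]
      rw [length_eliasEncode (Nat.le_add_left 1 _), eliasLength]
    · simp [eliasTerm, h]

/-- Since `M_i ≥ 1`, the encoded integer is at most `x i`. Symbols up to `B` pay the length at `B`
only when redacted; symbols above `B` pay their full length, redacted or not. -/
theorem eliasTerm_le (x : ℕ → ℕ+) {i : ℕ} (hi : 1 ≤ i) (B : ℕ) :
    eliasTerm x i ≤ eliasLength B * (if empThreshold x i < (x i : ℕ) then 1 else 0) +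
      (if B < (x i : ℕ) then eliasLength (x i) else 0) := by
  have hM := one_le_empThreshold x hi
  unfold eliasTerm
  by_cases h : IsRedacted x i
  · rw [if_pos h, if_pos h.2]
    have h2 := h.2
    split_ifs with hB
    · exact (eliasLength_mono (by omega)).trans (Nat.le_add_left _ _)
    · rw [mul_one, add_zero]
      exact eliasLength_mono (by omega)
  · rw [if_neg h]
    exact Nat.zero_le _

theorem eliasTerm_le_eliasLength (x : ℕ → ℕ+) (i : ℕ) : eliasTerm x i ≤ eliasLength (x i) := by
  unfold eliasTerm
  split_ifs with h
  · have := one_le_empThreshold x h.1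
    have := h.2
    exact eliasLength_mono (by omega)
  · exact Nat.zero_le _

end EliasLength

/-! ### Expectations under a memoryless source, uniform over the class. -/

section Source

theorem empThreshold_congr {x y : ℕ → ℕ+} {i : ℕ} (h : ∀ j < i, x j = y j) :
    empThreshold x i = empThreshold y i := by
  have : (Multiset.range i).map (fun j => (x j : ℕ)) =
      (Multiset.range i).map fun j => (y j : ℕ) :=
    Multiset.map_congr rfl fun j hj => by rw [h j (Multiset.mem_range.1 hj)]
  simp only [empThreshold, orderStat, this]

/-- Such a function factors through a countable discrete space. -/
theorem measurable_of_dependsOn {β : Type*} [MeasurableSpace β] [Nonempty β]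
    {g : (ℕ → ℕ+) → β} {s : Finset ℕ} (hg : DependsOn g s) : Measurable g := by
  obtain ⟨h, rfl⟩ := dependsOn_iff_exists_comp.1 hg
  have : Finite (s : Set ℕ).Elem := s.finite_toSet
  have : Countable ((s : Set ℕ).Elem → ℕ+) := inferInstance
  exact (measurable_of_countable h).comp (measurable_restrict _)

theorem measurable_eliasTerm (i : ℕ) : Measurable fun x : ℕ → ℕ+ => eliasTerm x i := by
  refine measurable_of_dependsOn (s := Finset.range (i + 1)) fun x y h => ?_
  have h1 : empThreshold x i = empThreshold y i :=
    empThreshold_congr fun j hj => h j (by simp; omega)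
  have h2 : x i = y i := h i (by simp)
  simp only [eliasTerm, IsRedacted, h1, h2]
  congr

variable (P₁ : Measure ℕ+) [IsProbabilityMeasure P₁]

theorem lintegral_infinitePi_comp_eval (i : ℕ) (g : ℕ+ → ℝ≥0∞) :
    ∫⁻ x, g (x i) ∂(Measure.infinitePi fun _ : ℕ => P₁) = ∫⁻ k, g k ∂P₁ :=
  (measurePreserving_eval_infinitePi (fun _ : ℕ => P₁) i).lintegral_comp
    (measurable_of_countable g)

/-- The law of an i.i.d. sequence is exchangeable. -/
theorem lintegral_infinitePi_comp_perm (σ : Equiv.Perm ℕ) {g : (ℕ → ℕ+) → ℝ≥0∞}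
    (hg : Measurable g) :
    ∫⁻ x, g (x ∘ σ) ∂(Measure.infinitePi fun _ : ℕ => P₁) =
      ∫⁻ x, g x ∂(Measure.infinitePi fun _ : ℕ => P₁) := by
  have hm : Measurable fun x : ℕ → ℕ+ => x ∘ σ :=
    measurable_pi_lambda _ fun i => measurable_pi_apply (σ i)
  have hmap : (Measure.infinitePi fun _ : ℕ => P₁).map (fun x => x ∘ σ) =
      Measure.infinitePi fun _ : ℕ => P₁ := by
    have h := Measure.infinitePi_map_piCongrLeft (X := fun _ : ℕ => ℕ+) (fun _ : ℕ => P₁) σ.symm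
    convert h using 2
    funext x i
    rw [MeasurableEquiv.coe_piCongrLeft]
    obtain ⟨j, rfl⟩ := σ.symm.surjective i
    rw [Equiv.piCongrLeft_apply_apply]
    simp
  rw [← lintegral_map hg hm, hmap]

theorem lintegral_exceedCount (i k : ℕ) :
    ∫⁻ x, (exceedCount x i k : ℝ≥0∞) ∂(Measure.infinitePi fun _ : ℕ => P₁) =
      i * P₁ {j | k < (j : ℕ)} := by
  have h : ∀ x : ℕ → ℕ+, (exceedCount x i k : ℝ≥0∞) =
      ∑ j ∈ Finset.range i, (if k < (x j : ℕ) then 1 else 0) := by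
    intro x
    rw [exceedCount, Finset.card_filter]
    push_cast
    rfl
  simp_rw [h]
  rw [lintegral_finsetSum]
  · have : ∀ j ∈ Finset.range i, ∫⁻ x, (if k < (x j : ℕ) then (1 : ℝ≥0∞) else 0)
        ∂(Measure.infinitePi fun _ : ℕ => P₁) = P₁ {j | k < (j : ℕ)} := by
      intro j _
      rw [lintegral_infinitePi_comp_eval P₁ j fun l => if k < (l : ℕ) then (1 : ℝ≥0∞) else 0,
        ← lintegral_indicator_one (MeasurableSet.of_discrete)]
      refine lintegral_congr fun l => ?_
      simp [indicator_apply]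
    rw [Finset.sum_congr rfl this]
    simp
  · intro j _
    exact (measurable_of_countable fun l : ℕ+ => if k < (l : ℕ) then (1 : ℝ≥0∞) else 0).comp
      (measurable_pi_apply j)

/-- The redaction probability is at most `(E[M_i] + 1) / (i + 1)`, and `M_i` is at most
`K` plus the number of symbols exceeding `K`. -/
theorem lintegral_redacted_le (i : ℕ) {K : ℕ} (hK : 1 ≤ K) :
    (i + 1 : ℝ≥0∞) * ∫⁻ x, (if empThreshold x i < (x i : ℕ) then 1 else 0)
        ∂(Measure.infinitePi fun _ : ℕ => P₁) ≤
      K + 1 + i * P₁ {j | K < (j : ℕ)} := by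
  set P := Measure.infinitePi fun _ : ℕ => P₁
  set g : (ℕ → ℕ+) → ℝ≥0∞ := fun x => if empThreshold x i < (x i : ℕ) then 1 else 0 with hg
  have hgm : Measurable g := by
    refine measurable_of_dependsOn (s := Finset.range (i + 1)) fun x y h => ?_
    have h1 : empThreshold x i = empThreshold y i :=
      empThreshold_congr fun j hj => h j (by simp; omega)
    have h2 : x i = y i := h i (by simp)
    simp only [hg, h1, h2]
  have hperm : ∀ σ : Equiv.Perm ℕ, Measurable fun x : ℕ → ℕ+ => g (x ∘ σ) := fun σ =>
    hgm.comp (measurable_pi_lambda _ fun i => measurable_pi_apply (σ i))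
  calc (i + 1 : ℝ≥0∞) * ∫⁻ x, g x ∂P
      = ∑ j ∈ Finset.range (i + 1), ∫⁻ x, g (x ∘ Equiv.swap j i) ∂P := by
        rw [Finset.sum_congr rfl fun j _ => lintegral_infinitePi_comp_perm P₁ (Equiv.swap j i) hgm]
        simp [P]
    _ = ∫⁻ x, ∑ j ∈ Finset.range (i + 1), g (x ∘ Equiv.swap j i) ∂P :=
        (lintegral_finsetSum _ fun j _ => hperm _).symm
    _ ≤ ∫⁻ x, ((K + 1 : ℝ≥0∞) + exceedCount x i K) ∂P := by
        refine lintegral_mono fun x => ?_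
        have h1 := card_filter_isRedacted_comp_swap_le x i
        have h2 := empThreshold_le_add x i hK
        have h3 : ∑ j ∈ Finset.range (i + 1), g (x ∘ Equiv.swap j i) =
            (((Finset.range (i + 1)).filter fun j =>
              empThreshold (x ∘ Equiv.swap j i) i < (x j : ℕ)).card : ℝ≥0∞) := by
          rw [Finset.card_filter]
          push_cast
          refine Finset.sum_congr rfl fun j _ => ?_
          simp [hg]
        rw [h3]
        have : ((Finset.range (i + 1)).filter fun j =>
          empThreshold (x ∘ Equiv.swap j i) i < (x j : ℕ)).card ≤ K + 1 + exceedCount x i K := by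
          omega
        have h := Nat.cast_le (α := ℝ≥0∞).2 this
        push_cast at h ⊢
        exact h
    _ = K + 1 + i * P₁ {j | K < (j : ℕ)} := by
        rw [lintegral_add_left measurable_const, lintegral_exceedCount P₁ i K]
        simp [P]

variable {f : ℕ+ → ℝ} {P₁}

/-- The envelope counterpart of the expected codeword length of a symbol exceeding `B`. -/
noncomputable def tailLength (f : ℕ+ → ℝ) (B : ℕ) : ℝ≥0∞ :=
  ∑' j : ℕ+, (if B < (j : ℕ) then (eliasLength j : ℝ≥0∞) else 0) * ENNReal.ofReal (f j)

theorem lintegral_tail_le (hP : ∀ j, P₁ {j} ≤ ENNReal.ofReal (f j)) (i B : ℕ) :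
    ∫⁻ x, (if B < (x i : ℕ) then (eliasLength (x i) : ℝ≥0∞) else 0)
      ∂(Measure.infinitePi fun _ : ℕ => P₁) ≤ tailLength f B := by
  rw [lintegral_infinitePi_comp_eval P₁ i
    fun l => if B < (l : ℕ) then (eliasLength l : ℝ≥0∞) else 0, lintegral_countable']
  exact ENNReal.tsum_le_tsum fun j => mul_le_mul_right (hP j) _

theorem ofReal_envelopeTail (hf : IsEnvelope f) (k : ℕ) :
    ENNReal.ofReal (envelopeTail f k) =
      ∑' j : ℕ+, if k < (j : ℕ) then ENNReal.ofReal (f j) else 0 := by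
  rw [envelopeTail, ENNReal.ofReal_tsum_of_nonneg _ (hf.summable_tail k)]
  · refine tsum_congr fun j => ?_
    split_ifs <;> simp
  · intro j
    split_ifs
    exacts [(hf.pos j).le, le_rfl]

theorem measure_tail_le {F : ℝ → ℝ} (hf : IsEnvelope f) (hF : IsSmoothedEnvelope f F)
    (hP : ∀ j, P₁ {j} ≤ ENNReal.ofReal (f j)) (k : ℕ) :
    P₁ {j | k < (j : ℕ)} ≤ ENNReal.ofReal (1 - F k) := by
  refine le_trans ?_ (ENNReal.ofReal_le_ofReal (hF.min_envelopeTail_le k))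
  rw [ENNReal.ofReal_min, ENNReal.ofReal_one]
  refine le_min prob_le_one ?_
  rw [ofReal_envelopeTail hf, ← lintegral_indicator_one MeasurableSet.of_discrete,
    lintegral_countable']
  refine ENNReal.tsum_le_tsum fun j => ?_
  simp only [indicator_apply, mem_ofPred_eq]
  split_ifs
  · simpa using hP j
  · simp

/-- With `K = ⌈m⌉₊`, the redaction bound has numerator `K + 1 + i (1 - F K) ≤ (m + 2) + m`, by the
equation defining the threshold. -/
theorem lintegral_eliasTerm_le {F : ℝ → ℝ} (hf : IsEnvelope f) (hF : IsSmoothedEnvelope f F)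
    (hP : ∀ j, P₁ {j} ≤ ENNReal.ofReal (f j)) {i : ℕ} (hi : 1 ≤ i) (B : ℕ) :
    ∫⁻ x, (eliasTerm x i : ℝ≥0∞) ∂(Measure.infinitePi fun _ : ℕ => P₁) ≤
      ENNReal.ofReal (eliasLength B * ((2 * exactThreshold F i + 2) / (i + 1))) +
        tailLength f B := by
  set P := Measure.infinitePi fun _ : ℕ => P₁
  set m := exactThreshold F i with hm
  have hi0 : (0 : ℝ) < i := by exact_mod_cast hi
  have hm0 : 0 < m := exactThreshold_pos hf hF hi0
  set K := ⌈m⌉₊ with hK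
  have hK1 : 1 ≤ K := Nat.one_le_ceil_iff.2 hm0
  have hmK : m ≤ K := Nat.le_ceil m
  have hKm : (K : ℝ) < m + 1 := Nat.ceil_lt_add_one hm0.le
  have hred : ∫⁻ x, (if empThreshold x i < (x i : ℕ) then (1 : ℝ≥0∞) else 0) ∂P ≤
      ENNReal.ofReal ((2 * m + 2) / (i + 1)) := by
    have h1 := lintegral_redacted_le P₁ i hK1
    have h2 : (i : ℝ≥0∞) * P₁ {j | K < (j : ℕ)} ≤ ENNReal.ofReal m := by
      have h3 : 1 - F K ≤ m / i := by
        rw [← exactThreshold_spec hf hF hi0, ← hm]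
        linarith [hF.mono hmK]
      calc (i : ℝ≥0∞) * P₁ {j | K < (j : ℕ)}
          ≤ i * ENNReal.ofReal (m / i) := by
            gcongr
            exact (measure_tail_le hf hF hP K).trans (ENNReal.ofReal_le_ofReal h3)
        _ = ENNReal.ofReal m := by
            rw [← ENNReal.ofReal_natCast, ← ENNReal.ofReal_mul hi0.le, mul_div_cancel₀ _ hi0.ne']
    rw [ENNReal.ofReal_div_of_pos (by positivity), ENNReal.le_div_iff_mul_le (by left; simp; positivity)
      (by left; simp), mul_comm]
    calc ENNReal.ofReal (i + 1) * _ = (i + 1 : ℝ≥0∞) * _ := by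
          rw [ENNReal.ofReal_add hi0.le zero_le_one, ENNReal.ofReal_natCast, ENNReal.ofReal_one]
      _ ≤ K + 1 + i * P₁ {j | K < (j : ℕ)} := h1
      _ ≤ K + 1 + ENNReal.ofReal m := by gcongr
      _ = ENNReal.ofReal (K + 1 + m) := by
          rw [ENNReal.ofReal_add (by positivity) hm0.le, ENNReal.ofReal_add (by positivity) zero_le_one,
            ENNReal.ofReal_natCast, ENNReal.ofReal_one]
      _ ≤ ENNReal.ofReal (2 * m + 2) := ENNReal.ofReal_le_ofReal (by linarith)
  calc ∫⁻ x, (eliasTerm x i : ℝ≥0∞) ∂P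
      ≤ ∫⁻ x, (eliasLength B * (if empThreshold x i < (x i : ℕ) then (1 : ℝ≥0∞) else 0) +
          (if B < (x i : ℕ) then (eliasLength (x i) : ℝ≥0∞) else 0)) ∂P := by
        refine lintegral_mono fun x => ?_
        have h := Nat.cast_le (α := ℝ≥0∞).2 (eliasTerm_le x hi B)
        push_cast at h
        exact h
    _ = eliasLength B * ∫⁻ x, (if empThreshold x i < (x i : ℕ) then (1 : ℝ≥0∞) else 0) ∂P +
          ∫⁻ x, (if B < (x i : ℕ) then (eliasLength (x i) : ℝ≥0∞) else 0) ∂P := by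
        rw [lintegral_add_right, lintegral_const_mul' _ _ (by simp)]
        exact (measurable_of_countable fun l : ℕ+ => if B < (l : ℕ) then (eliasLength l : ℝ≥0∞)
          else 0).comp (measurable_pi_apply i)
    _ ≤ _ := by
        rw [ENNReal.ofReal_mul (by positivity), ENNReal.ofReal_natCast]
        gcongr
        exact lintegral_tail_le hP i B

/-- This serves the finitely many early symbols, to which the asymptotic estimate does not apply. -/
theorem lintegral_eliasTerm_le_tailLength_zero (hP : ∀ j, P₁ {j} ≤ ENNReal.ofReal (f j)) (i : ℕ) :
    ∫⁻ x, (eliasTerm x i : ℝ≥0∞) ∂(Measure.infinitePi fun _ : ℕ => P₁) ≤ tailLength f 0 := by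
  refine le_trans (lintegral_mono fun x => ?_) (lintegral_tail_le hP i 0)
  rw [if_pos (x i).pos]
  exact Nat.cast_le.2 (eliasTerm_le_eliasLength x i)

theorem expEliasLength_eq (P : Measure (ℕ → ℕ+)) [IsProbabilityMeasure P] (n : ℕ) :
    expEliasLength P n = ∑ i ∈ Finset.range n, ∫⁻ x, (eliasTerm x i : ℝ≥0∞) ∂P + 3 := by
  have : ∀ i, Measurable fun x : ℕ → ℕ+ => (eliasTerm x i : ℝ≥0∞) := fun i =>
    (measurable_of_countable _).comp (measurable_eliasTerm i)
  simp only [expEliasLength, length_eliasString, Nat.cast_add, Nat.cast_sum, Nat.cast_ofNat]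
  rw [lintegral_add_right _ measurable_const, lintegral_finsetSum _ fun i _ => this i]
  simp

end Source

/-! ### Asymptotics of the Elias codeword length. -/

section Lengths

theorem one_le_binLength (y : ℕ) : 1 ≤ binLength y := Nat.le_add_left 1 _

theorem binLength_le_self {z : ℕ} (hz : 1 ≤ z) : binLength z ≤ z := by
  rw [binLength, max_eq_left hz]
  exact Nat.log_lt_self 2 (by omega)

theorem eliasLength_le (y : ℕ) : eliasLength y ≤ 3 * binLength y := by
  have := binLength_le_self (one_le_binLength y)
  unfold eliasLength
  omega

theorem binLength_le_eliasLength (y : ℕ) : binLength y ≤ eliasLength y := Nat.le_add_left _ _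

theorem binLength_two_pow_mul (k : ℕ) {B : ℕ} (hB : 1 ≤ B) :
    binLength (2 ^ k * B) = binLength B + k := by
  induction k with
  | zero => simp
  | succ k ih =>
    have h1 : 1 ≤ 2 ^ k * B := Nat.mul_pos (by positivity) hB
    rw [pow_succ, mul_assoc, mul_left_comm, ← add_assoc, ← ih, binLength, binLength,
      max_eq_left h1, max_eq_left (by omega), mul_comm 2, Nat.log_mul_base (by norm_num) (by omega)]

theorem binLength_le_logb {y : ℕ} (hy : 1 ≤ y) : (binLength y : ℝ) ≤ Real.logb 2 y + 1 := by
  rw [binLength, max_eq_left hy]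
  push_cast
  have := Real.natLog_le_logb y 2
  push_cast at this
  linarith

/-- The fixed factor `2 ^ r` and the ceiling add only a constant to the binary length, and the
iterated length is of order `log log m`. -/
theorem eventually_eliasLength_le (r : ℕ) {η : ℝ} (hη : 0 < η) :
    ∀ᶠ m : ℝ in atTop, (eliasLength (2 ^ r * ⌈m⌉₊) : ℝ) ≤ (1 + η) * Real.logb 2 m := by
  have hs : Tendsto (Real.logb 2) atTop atTop := Real.tendsto_logb_atTop (by norm_num)
  have hl2 : 0 < Real.log 2 := Real.log_pos (by norm_num)
  have hshift : Tendsto (fun s : ℝ => s + (r + 2)) atTop atTop :=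
    tendsto_atTop_add_const_right _ _ tendsto_id
  have hlog : ∀ᶠ s : ℝ in atTop, Real.logb 2 (s + (r + 2)) ≤ η / 4 * (s + (r + 2)) := by
    have := hshift.eventually
      (Real.isLittleO_log_id_atTop.bound (show 0 < η / 4 * Real.log 2 by positivity))
    filter_upwards [this, eventually_ge_atTop 0] with s h h0
    have hn : ‖s + ((r : ℝ) + 2)‖ = s + (r + 2) := Real.norm_of_nonneg (by positivity)
    rw [id, hn] at h
    rw [Real.logb, div_le_iff₀ hl2]
    calc _ ≤ _ := Real.le_norm_self _
      _ ≤ _ := h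
      _ = _ := by ring
  filter_upwards [eventually_ge_atTop 1, hs.eventually hlog,
    hs.eventually (eventually_ge_atTop ((2 + (1 + η / 2) * (r + 2)) / (η / 2)))] with m hm h1 h2
  have hK1 : 1 ≤ ⌈m⌉₊ := Nat.one_le_ceil_iff.2 (by linarith)
  have hKm : (⌈m⌉₊ : ℝ) ≤ 2 * m := by linarith [Nat.ceil_lt_add_one (show 0 ≤ m by linarith)]
  set s := Real.logb 2 m with hsdef
  have hs0 : 0 ≤ s := Real.logb_nonneg (by norm_num) hm
  have hb : (binLength (2 ^ r * ⌈m⌉₊) : ℝ) ≤ s + (r + 2) := by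
    rw [binLength_two_pow_mul r hK1]
    push_cast
    have h3 := binLength_le_logb hK1
    have h4 : Real.logb 2 ⌈m⌉₊ ≤ 1 + s := by
      rw [hsdef]
      calc Real.logb 2 ⌈m⌉₊ ≤ Real.logb 2 (2 * m) :=
            Real.logb_le_logb_of_le (by norm_num) (by exact_mod_cast hK1) hKm
        _ = 1 + Real.logb 2 m := by
            rw [Real.logb_mul (by norm_num) (by linarith), Real.logb_self_eq_one (by norm_num)]
    linarith
  have hbb : (binLength (binLength (2 ^ r * ⌈m⌉₊)) : ℝ) ≤ Real.logb 2 (s + (r + 2)) + 1 := by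
    refine (binLength_le_logb (one_le_binLength _)).trans ?_
    gcongr
    · norm_num
    · exact_mod_cast one_le_binLength _
  rw [div_le_iff₀ (by positivity)] at h2
  rw [eliasLength]
  push_cast
  nlinarith

end Lengths

/-! ### Contribution of large symbols, and the bound for one symbol. -/

section Tail

variable {f : ℕ+ → ℝ} {F : ℝ → ℝ}

theorem compl_two_pow_mul_le {c Y : ℝ} (hc : 0 ≤ c) (hY0 : 0 ≤ Y)
    (hY : ∀ y, Y ≤ y → 1 - F (2 * y) ≤ c * (1 - F y)) {y : ℝ} (hy : Y ≤ y) (k : ℕ) :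
    1 - F (2 ^ k * y) ≤ c ^ k * (1 - F y) := by
  induction k with
  | zero => simp
  | succ k ih =>
    have h1 : Y ≤ 2 ^ k * y :=
      hy.trans (le_mul_of_one_le_left (hY0.trans hy) (one_le_pow₀ (by norm_num)))
    have h2 := hY _ h1
    have h3 := mul_le_mul_of_nonneg_left ih hc
    rw [pow_succ', pow_succ', mul_assoc, mul_assoc]
    linarith

/-- Split the symbols beyond `B` into blocks `2 ^ k B < j ≤ 2 ^ (k + 1) B`. Lengths in block `k` are
at most `3 (k + 2) binLength B`, while its envelope mass is at most `c ^ k (1 - F B)`; the series `∑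
(k + 2) c ^ k` converges. -/
theorem exists_tailLength_le (hf : IsEnvelope f) (hF : IsSmoothedEnvelope f F) {c : ℝ}
    (hc0 : 0 < c) (hc1 : c < 1) (h : ∀ᶠ y in atTop, 1 - F (2 * y) ≤ c * (1 - F y)) :
    ∃ C : ℝ, 0 < C ∧ ∀ᶠ B : ℕ in atTop,
      tailLength f B ≤ ENNReal.ofReal (C * binLength B * (1 - F B)) := by
  obtain ⟨Y, hY⟩ := eventually_atTop.1 h
  have hsum : Summable fun k : ℕ => ((k : ℝ) + 2) * c ^ k := by
    have h1 := summable_pow_mul_geometric_of_norm_lt_one 1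
      (show ‖c‖ < 1 by rwa [Real.norm_of_nonneg hc0.le])
    have h2 := (summable_geometric_of_lt_one hc0.le hc1).mul_left 2
    refine (h1.add h2).congr fun k => ?_
    ring
  have hpos : 0 < ∑' k : ℕ, ((k : ℝ) + 2) * c ^ k :=
    hsum.tsum_pos (fun k => by positivity) 0 (by norm_num)
  refine ⟨3 * ∑' k : ℕ, ((k : ℝ) + 2) * c ^ k, by positivity, ?_⟩
  obtain ⟨N, hN⟩ := eventually_atTop.1 hF.eventually_envelopeTail
  filter_upwards [eventually_ge_atTop 1, eventually_ge_atTop N,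
    tendsto_natCast_atTop_atTop.eventually (eventually_ge_atTop (max Y 0))] with B hB1 hBN hBY
  have hp : 0 < 1 - F B := sub_pos.2 (hF.lt_one hf B)
  have hterm : ∀ j : ℕ+,
      (if B < (j : ℕ) then (eliasLength j : ℝ≥0∞) else 0) * ENNReal.ofReal (f j) ≤
      ∑' k : ℕ, (eliasLength (2 ^ (k + 1) * B) : ℝ≥0∞) *
        (if 2 ^ k * B < (j : ℕ) then ENNReal.ofReal (f j) else 0) := by
    intro j
    split_ifs with hj
    · have hex : ∃ k, (j : ℕ) ≤ 2 ^ (k + 1) * B :=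
        ⟨j, (Nat.lt_two_pow_self.le.trans (Nat.pow_le_pow_right (by norm_num) (Nat.le_succ _))).trans
          (Nat.le_mul_of_pos_right _ hB1)⟩
      obtain ⟨k, hk, hmin⟩ : ∃ k, (j : ℕ) ≤ 2 ^ (k + 1) * B ∧
          ∀ l < k, ¬ (j : ℕ) ≤ 2 ^ (l + 1) * B :=
        ⟨Nat.find hex, Nat.find_spec hex, fun l hl => Nat.find_min hex hl⟩
      have hk' : 2 ^ k * B < (j : ℕ) := by
        rcases k with _ | k
        · simpa using hj
        · exact not_le.1 (hmin k (Nat.lt_succ_self k))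
      refine le_trans ?_ (ENNReal.le_tsum k)
      rw [if_pos hk']
      gcongr
      exact eliasLength_mono hk
    · simp
  calc tailLength f B
      ≤ ∑' j : ℕ+, ∑' k : ℕ, (eliasLength (2 ^ (k + 1) * B) : ℝ≥0∞) *
        (if 2 ^ k * B < (j : ℕ) then ENNReal.ofReal (f j) else 0) := ENNReal.tsum_le_tsum hterm
    _ = ∑' k : ℕ, (eliasLength (2 ^ (k + 1) * B) : ℝ≥0∞) *
        ENNReal.ofReal (envelopeTail f (2 ^ k * B)) := by
        rw [ENNReal.tsum_comm]
        refine tsum_congr fun k => ?_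
        rw [ENNReal.tsum_mul_left, ofReal_envelopeTail hf]
    _ ≤ ∑' k : ℕ, ENNReal.ofReal (3 * binLength B * (1 - F B) * (((k : ℝ) + 2) * c ^ k)) := by
        refine ENNReal.tsum_le_tsum fun k => ?_
        rw [← ENNReal.ofReal_natCast, ← ENNReal.ofReal_mul (by positivity)]
        refine ENNReal.ofReal_le_ofReal ?_
        have h1 : (eliasLength (2 ^ (k + 1) * B) : ℝ) ≤ 3 * (binLength B * (k + 2)) := by
          have h2 := eliasLength_le (2 ^ (k + 1) * B)
          rw [binLength_two_pow_mul _ hB1] at h2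
          have h3 : binLength B + (k + 1) ≤ binLength B * (k + 2) := by
            nlinarith [one_le_binLength B]
          exact_mod_cast h2.trans (Nat.mul_le_mul_left 3 h3)
        have h4 : envelopeTail f (2 ^ k * B) ≤ c ^ k * (1 - F B) := by
          rw [hN _ (hBN.trans (Nat.le_mul_of_pos_left _ (by positivity)))]
          push_cast
          exact compl_two_pow_mul_le hc0.le (le_max_right Y 0)
            (fun y hy => hY y ((le_max_left _ _).trans hy)) hBY k
        calc _ ≤ 3 * ((binLength B : ℝ) * (k + 2)) * (c ^ k * (1 - F B)) := by
              gcongr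
              exact (hf.envelopeTail_pos _).le
          _ = _ := by ring
    _ = ENNReal.ofReal (∑' k : ℕ, 3 * binLength B * (1 - F B) * (((k : ℝ) + 2) * c ^ k)) :=
        (ENNReal.ofReal_tsum_of_nonneg (fun k => by positivity) (hsum.mul_left _)).symm
    _ = _ := by
        rw [tsum_mul_left]
        congr 1
        ring

theorem tailLength_zero_ne_top (hf : IsEnvelope f) (hF : IsSmoothedEnvelope f F) {c : ℝ}
    (hc0 : 0 < c) (hc1 : c < 1) (h : ∀ᶠ y in atTop, 1 - F (2 * y) ≤ c * (1 - F y)) :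
    tailLength f 0 ≠ ∞ := by
  obtain ⟨C, -, hC⟩ := exists_tailLength_le hf hF hc0 hc1 h
  obtain ⟨B, hB⟩ := hC.exists
  have hle : tailLength f 0 ≤
      ∑' j : ℕ+, (eliasLength B : ℝ≥0∞) * ENNReal.ofReal (f j) + tailLength f B := by
    rw [tailLength, tailLength, ← ENNReal.tsum_add]
    refine ENNReal.tsum_le_tsum fun j => ?_
    rw [if_pos j.pos, ← add_mul]
    gcongr
    split_ifs with hj
    · exact le_add_self
    · rw [add_zero]
      exact Nat.cast_le.2 (eliasLength_mono (not_lt.1 hj))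
  refine ne_top_of_le_ne_top ?_ hle
  rw [ENNReal.tsum_mul_left, ← ENNReal.ofReal_tsum_of_nonneg (fun j => (hf.pos j).le) hf.summable]
  exact ENNReal.add_ne_top.2 ⟨ENNReal.mul_ne_top (by simp) ENNReal.ofReal_ne_top,
    ne_top_of_le_ne_top ENNReal.ofReal_ne_top hB⟩

/-- Uniformly over the envelope class, the expected contribution of a late symbol. -/
theorem eventually_lintegral_eliasTerm_le (hf : IsEnvelope f) (hF : IsSmoothedEnvelope f F) {c : ℝ}
    (hc0 : 0 < c) (hc1 : c < 1) (h : ∀ᶠ y in atTop, 1 - F (2 * y) ≤ c * (1 - F y))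
    {ε : ℝ} (hε : 0 < ε) :
    ∀ᶠ i : ℕ in atTop, ∀ P ∈ envelopeClass f, ∫⁻ x, (eliasTerm x i : ℝ≥0∞) ∂P ≤
      ENNReal.ofReal ((2 + ε) * (exactThreshold F i * Real.logb 2 (exactThreshold F i) /
        (i + 1))) := by
  obtain ⟨C, hC0, hC⟩ := exists_tailLength_le hf hF hc0 hc1 h
  obtain ⟨N, hN⟩ := eventually_atTop.1 hC
  obtain ⟨Y, hY⟩ := eventually_atTop.1 h
  -- The symbols above `B = 2 ^ r ⌈m⌉₊` will contribute at most `4 C c ^ r` times `m log m / (i +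
  -- 1)`, whatever `i`, so `r` can be fixed beforehand.
  obtain ⟨r, hr⟩ : ∃ r : ℕ, 4 * C * c ^ r ≤ ε / 2 := by
    have h1 : Tendsto (fun r : ℕ => 4 * C * c ^ r) atTop (𝓝 0) := by
      simpa using (tendsto_pow_atTop_nhds_zero_of_lt_one hc0.le hc1).const_mul (4 * C)
    obtain ⟨r, hr⟩ := (h1.eventually (gt_mem_nhds (show 0 < ε / 2 by positivity))).exists
    exact ⟨r, hr.le⟩
  set η := min 1 (ε / 8) with hη
  have hη0 : 0 < η := by positivity
  have hη1 : η ≤ 1 := min_le_left _ _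
  have hη2 : η ≤ ε / 8 := min_le_right _ _
  have hm := (tendsto_exactThreshold hf hF).comp (tendsto_natCast_atTop_atTop (R := ℝ))
  filter_upwards [eventually_ge_atTop 1, hm.eventually (eventually_eliasLength_le r hη0),
    hm.eventually (eventually_ge_atTop 1), hm.eventually (eventually_ge_atTop (16 / ε)),
    hm.eventually (eventually_ge_atTop (max Y 0)), hm.eventually (eventually_ge_atTop (N : ℝ))]
    with i hi hL hm1 hmε hmY hmN
  rintro P ⟨P₁, hP₁, hP, rfl⟩
  simp only [Function.comp_apply] at hL hm1 hmε hmY hmN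
  have hi0 : (1 : ℝ) ≤ i := by exact_mod_cast hi
  have hspec := exactThreshold_spec hf hF (show (0 : ℝ) < i by linarith)
  set m := exactThreshold F i with hmdef
  set K := ⌈m⌉₊ with hK
  set B := 2 ^ r * K with hB
  set s := Real.logb 2 m with hs
  have hs0 : 0 ≤ s := Real.logb_nonneg (by norm_num) hm1
  have hmK : m ≤ K := Nat.le_ceil m
  have hKB : K ≤ B := Nat.le_mul_of_pos_left _ (by positivity)
  have hNB : N ≤ B := by
    have h1 : (N : ℝ) ≤ K := hmN.trans hmK
    have h2 : N ≤ K := by exact_mod_cast h1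
    omega
  have hFB : 1 - F B ≤ c ^ r * (m / i) := by
    rw [← hspec]
    have h1 := compl_two_pow_mul_le hc0.le (le_max_right Y 0)
      (fun y hy => hY y ((le_max_left _ _).trans hy)) (hmY.trans hmK) r
    have h2 := hF.mono hmK
    have h3 : c ^ r * (1 - F K) ≤ c ^ r * (1 - F m) := by gcongr
    rw [hB]
    push_cast
    linarith
  have hFB0 : 0 ≤ 1 - F B := (sub_pos.2 (hF.lt_one hf B)).le
  have hb : (binLength B : ℝ) ≤ (1 + η) * s :=
    le_trans (by exact_mod_cast binLength_le_eliasLength B) hL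
  refine (lintegral_eliasTerm_le hf hF hP hi B).trans ?_
  refine (add_le_add le_rfl (hN B hNB)).trans ?_
  rw [← hmdef, ← ENNReal.ofReal_add (by positivity) (by positivity)]
  refine ENNReal.ofReal_le_ofReal ?_
  set q := m / (i + 1) with hq
  have hq0 : 0 ≤ q := by positivity
  have h1 : (2 * m + 2) / ((i : ℝ) + 1) ≤ (2 + ε / 8) * q := by
    rw [hq, ← mul_div_assoc]
    gcongr
    rw [div_le_iff₀ hε] at hmε
    nlinarith
  have h2 : m / i ≤ 2 * q := by
    rw [hq, ← mul_div_assoc, div_le_div_iff₀ (by linarith) (by linarith)]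
    nlinarith
  have h3 : (eliasLength B : ℝ) * ((2 * m + 2) / (i + 1)) ≤ (1 + η) * s * ((2 + ε / 8) * q) :=
    mul_le_mul hL h1 (by positivity) (by positivity)
  have h4 : C * binLength B * (1 - F B) ≤ C * (2 * s) * (c ^ r * (2 * q)) := by
    have : (binLength B : ℝ) ≤ 2 * s := by nlinarith
    have : 1 - F B ≤ c ^ r * (2 * q) := hFB.trans (by gcongr)
    gcongr
  have h5 : (1 + η) * (2 + ε / 8) + 4 * C * c ^ r ≤ 2 + ε := by nlinarith
  have h6 : 0 ≤ s * q := by positivity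
  calc _ ≤ _ := add_le_add h3 h4
    _ = ((1 + η) * (2 + ε / 8) + 4 * C * c ^ r) * (s * q) := by ring
    _ ≤ (2 + ε) * (s * q) := by gcongr
    _ = _ := by rw [hq]; ring

/-- Uniformly over the envelope class, the expected Elias length is at most a constant plus
`2 + ε` times a sum over the exact thresholds. -/
theorem exists_expEliasLength_le (hf : IsEnvelope f) (hF : IsSmoothedEnvelope f F) {c : ℝ}
    (hc0 : 0 < c) (hc1 : c < 1) (h : ∀ᶠ y in atTop, 1 - F (2 * y) ≤ c * (1 - F y))
    {ε : ℝ} (hε : 0 < ε) :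
    ∃ (i₀ : ℕ) (C : ℝ), 1 ≤ i₀ ∧ 2 ≤ exactThreshold F i₀ ∧ ∀ n ≥ i₀, ∀ P ∈ envelopeClass f,
      expEliasLength P n ≤ ENNReal.ofReal (C + (2 + ε) * ∑ i ∈ Finset.Ico i₀ n,
        exactThreshold F i * Real.logb 2 (exactThreshold F i) / (i + 1)) := by
  have hm := (tendsto_exactThreshold hf hF).comp (tendsto_natCast_atTop_atTop (R := ℝ))
  obtain ⟨i₀, hi₀⟩ := eventually_atTop.1 ((eventually_lintegral_eliasTerm_le hf hF hc0 hc1 h hε).and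
    ((hm.eventually (eventually_ge_atTop 2)).and (eventually_ge_atTop 1)))
  have htop := tailLength_zero_ne_top hf hF hc0 hc1 h
  refine ⟨i₀, i₀ * (tailLength f 0).toReal + 3, (hi₀ i₀ le_rfl).2.2, (hi₀ i₀ le_rfl).2.1,
    fun n hn P hP => ?_⟩
  have hprob : IsProbabilityMeasure P := by
    obtain ⟨P₁, hP₁, -, rfl⟩ := hP
    infer_instance
  have hnonneg : ∀ i ∈ Finset.Ico i₀ n,
      0 ≤ (2 + ε) * (exactThreshold F i * Real.logb 2 (exactThreshold F i) / ((i : ℝ) + 1)) := by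
    intro i hi
    have h1 : (2 : ℝ) ≤ exactThreshold F i := (hi₀ i (Finset.mem_Ico.1 hi).1).2.1
    have h2 : 0 ≤ Real.logb 2 (exactThreshold F i) := Real.logb_nonneg (by norm_num) (by linarith)
    positivity
  rw [expEliasLength_eq, ← Finset.sum_range_add_sum_Ico _ hn, Finset.mul_sum,
    ENNReal.ofReal_add (by positivity) (Finset.sum_nonneg hnonneg),
    ENNReal.ofReal_sum_of_nonneg hnonneg, add_right_comm,
    ENNReal.ofReal_add (by positivity) (by norm_num), ENNReal.ofReal_mul (by positivity),
    ENNReal.ofReal_natCast, ENNReal.ofReal_toReal htop, ENNReal.ofReal_ofNat]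
  gcongr with i hi
  · calc ∑ i ∈ Finset.range i₀, ∫⁻ x, (eliasTerm x i : ℝ≥0∞) ∂P
        ≤ ∑ i ∈ Finset.range i₀, tailLength f 0 := by
          refine Finset.sum_le_sum fun i _ => ?_
          obtain ⟨P₁, hP₁, hP', rfl⟩ := hP
          exact lintegral_eliasTerm_le_tailLength_zero hP' i
      _ = i₀ * tailLength f 0 := by simp
  · exact (hi₀ i (Finset.mem_Ico.1 hi).1).1 P hP

end Tail

/-! ### From one symbol to the first three bounds. -/

section Bounds

variable {f : ℕ+ → ℝ} {F : ℝ → ℝ} {b b' : ℕ → ℝ}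

/-- `E[ℓ(C_E)] ≤ (2 + ε) b(n)` eventually, for each `ε > 0`, uniformly over the envelope class. -/
def AsympEliasBound (f : ℕ+ → ℝ) (b : ℕ → ℝ) : Prop :=
  ∀ ε : ℝ, 0 < ε → ∀ᶠ n in atTop, ∀ P ∈ envelopeClass f,
    expEliasLength P n ≤ ENNReal.ofReal ((2 + ε) * b n)

/-- Let `δ n` be an admissible `ε` within `1 / (n + 1)` of the infimum of all admissible ones; each
fixed `ε > 0` is eventually admissible, so `δ` tends to 0. -/
theorem AsympEliasBound.eliasBound (h : AsympEliasBound f b) : EliasBound f b := by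
  classical
  set S : ℕ → Set ℝ := fun n => {ε | 0 < ε ∧ ∀ P ∈ envelopeClass f,
    expEliasLength P n ≤ ENNReal.ofReal ((2 + ε) * b n)} with hS
  have hbdd : ∀ n, BddBelow (S n) := fun n => ⟨0, fun ε hε => hε.1.le⟩
  have hex : ∀ n, ∃ δ, (S n).Nonempty → δ ∈ S n ∧ δ < sInf (S n) + 1 / ((n : ℝ) + 1) := by
    intro n
    by_cases hn : (S n).Nonempty
    · obtain ⟨δ, hδ, hlt⟩ := exists_lt_of_csInf_lt hn
        (show sInf (S n) < sInf (S n) + 1 / ((n : ℝ) + 1) from lt_add_of_pos_right _ (by positivity))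
      exact ⟨δ, fun _ => ⟨hδ, hlt⟩⟩
    · exact ⟨0, fun h => absurd h hn⟩
  choose δ hδ using hex
  have hmem : ∀ ε, 0 < ε → ∀ᶠ n in atTop, ε ∈ S n := fun ε hε =>
    (h ε hε).mono fun n hn => ⟨hε, hn⟩
  refine ⟨δ, ?_, ?_⟩
  · refine tendsto_order.2 ⟨fun a ha => ?_, fun a ha => ?_⟩
    · filter_upwards [hmem 1 one_pos] with n hn
      exact ha.trans (hδ n ⟨1, hn⟩).1.1
    · filter_upwards [hmem (a / 2) (by positivity),
        tendsto_one_div_add_atTop_nhds_zero_nat.eventually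
          (gt_mem_nhds (show 0 < a / 2 by positivity))] with n hn h1
      have h2 := (hδ n ⟨_, hn⟩).2
      have h3 := csInf_le (hbdd n) hn
      linarith
  · filter_upwards [hmem 1 one_pos] with n hn
    exact (hδ n ⟨1, hn⟩).1.2

theorem AsympEliasBound.mono (h : AsympEliasBound f b)
    (hb : ∀ ε : ℝ, 0 < ε → ∀ᶠ n in atTop, b n ≤ (1 + ε) * b' n)
    (hb' : ∀ᶠ n in atTop, 0 ≤ b' n) : AsympEliasBound f b' := by
  intro ε hε
  have hδ : 0 < min 1 (ε / 4) := by positivity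
  have hδ1 := min_le_left 1 (ε / 4)
  have hδ2 := min_le_right 1 (ε / 4)
  set δ := min 1 (ε / 4)
  filter_upwards [h δ hδ, hb δ hδ, hb'] with n h1 h2 h3 P hP
  refine (h1 P hP).trans (ENNReal.ofReal_le_ofReal ?_)
  calc (2 + δ) * b n ≤ (2 + δ) * ((1 + δ) * b' n) := by gcongr
    _ = ((2 + δ) * (1 + δ)) * b' n := by ring
    _ ≤ (2 + ε) * b' n := by
        gcongr
        nlinarith

/-- Only the larger argument need be at least 1: below 1 the left side may be negative, where `x log
x` is not monotone. -/
theorem mul_logb_mono {x y : ℝ} (hx : 0 < x) (hxy : x ≤ y) (hy : 1 ≤ y) :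
    x * Real.logb 2 x ≤ y * Real.logb 2 y := by
  have hy0 : 0 ≤ Real.logb 2 y := Real.logb_nonneg (by norm_num) hy
  have hlog : Real.logb 2 x ≤ Real.logb 2 y := Real.logb_le_logb_of_le (by norm_num) hx hxy
  nlinarith

/-- An asymptotic bound by any sequence that dominates the sums over the exact thresholds up to an
additive constant. -/
theorem asympEliasBound_of_sum_le (hf : IsEnvelope f) (hF : IsSmoothedEnvelope f F) {γ : ℝ}
    (hγ : 0 ≤ γ) (hmda : InMDA F γ)
    (hb : ∀ i₀ : ℕ, 1 ≤ i₀ → 2 ≤ exactThreshold F i₀ → ∃ C, ∀ n ≥ i₀, ∑ i ∈ Finset.Ico i₀ n,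
      exactThreshold F i * Real.logb 2 (exactThreshold F i) / ((i : ℝ) + 1) ≤ b n + C) :
    AsympEliasBound f b := by
  intro ε hε
  obtain ⟨c, hc0, hc1, hc⟩ := hmda.eventually_compl_two_mul_le hf hF hγ
  obtain ⟨i₀, C, hi₀, hm₀, hC⟩ :=
    exists_expEliasLength_le hf hF hc0 hc1 hc (show 0 < ε / 2 by positivity)
  obtain ⟨C', hC'⟩ := hb i₀ hi₀ hm₀
  -- Each summand is at least `1 / (i + 1)`, as the thresholds are at least 2. Divergence of the
  -- harmonic series lets `b` absorb all additive constants.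
  have hbtop : Tendsto b atTop atTop := by
    have h1 : Tendsto (fun n : ℕ => ∑ i ∈ Finset.range n, 1 / ((i : ℝ) + 1) +
        (-∑ i ∈ Finset.range i₀, 1 / ((i : ℝ) + 1) - C')) atTop atTop :=
      tendsto_atTop_add_const_right _ _ Real.tendsto_sum_range_one_div_nat_succ_atTop
    refine tendsto_atTop_mono' _ ?_ h1
    filter_upwards [eventually_ge_atTop i₀] with n hn
    have h2 := hC' n hn
    have h3 : ∑ i ∈ Finset.Ico i₀ n, 1 / ((i : ℝ) + 1) ≤ ∑ i ∈ Finset.Ico i₀ n,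
        exactThreshold F i * Real.logb 2 (exactThreshold F i) / ((i : ℝ) + 1) := by
      refine Finset.sum_le_sum fun i hi => ?_
      have h4 : (2 : ℝ) ≤ exactThreshold F i := hm₀.trans (exactThreshold_mono hf hF
        (by exact_mod_cast hi₀) (by exact_mod_cast (Finset.mem_Ico.1 hi).1))
      have h5 : 1 ≤ Real.logb 2 (exactThreshold F i) := by
        rw [Real.le_logb_iff_rpow_le (by norm_num) (by linarith)]
        simpa using h4
      gcongr
      nlinarith
    rw [← Finset.sum_range_add_sum_Ico _ hn]
    linarith
  filter_upwards [eventually_ge_atTop i₀,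
    hbtop.eventually (eventually_ge_atTop ((C + (2 + ε / 2) * C') / (ε / 2)))] with n hn h1 P hP
  refine (hC n hn P hP).trans (ENNReal.ofReal_le_ofReal ?_)
  rw [div_le_iff₀ (by positivity)] at h1
  have h2 := mul_le_mul_of_nonneg_left (hC' n hn) (show 0 ≤ 2 + ε / 2 by positivity)
  linarith

theorem asympEliasBound_sum (hf : IsEnvelope f) (hF : IsSmoothedEnvelope f F) {γ : ℝ}
    (hγ : 0 ≤ γ) (hmda : InMDA F γ) :
    AsympEliasBound f fun n => ∑ i ∈ Finset.Icc 1 n,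
      1 / (i : ℝ) * (exactThreshold F i * Real.logb 2 (exactThreshold F i)) := by
  refine asympEliasBound_of_sum_le hf hF hγ hmda fun i₀ hi₀ hm₀ => ?_
  set w : ℕ → ℝ := fun i =>
    1 / (i : ℝ) * (exactThreshold F i * Real.logb 2 (exactThreshold F i)) with hw
  -- Terms before `i₀` may be negative, since a threshold below 1 has a negative logarithm; the
  -- constant removes them exactly.
  refine ⟨-∑ i ∈ Finset.Ico 1 i₀, w i, fun n hn => ?_⟩
  have h1 : ∑ i ∈ Finset.Icc 1 n, w i =
      ∑ i ∈ Finset.Ico 1 i₀, w i + ∑ i ∈ Finset.Ico i₀ (n + 1), w i := by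
    rw [Finset.sum_Ico_consecutive _ hi₀ (by omega)]
    rfl
  have hp : ∀ i, i₀ ≤ i →
      0 ≤ exactThreshold F (i : ℝ) * Real.logb 2 (exactThreshold F (i : ℝ)) := by
    intro i hi
    have h4 : (2 : ℝ) ≤ exactThreshold F i := hm₀.trans (exactThreshold_mono hf hF
      (by exact_mod_cast hi₀) (by exact_mod_cast hi))
    have h5 : 0 ≤ Real.logb 2 (exactThreshold F i) := Real.logb_nonneg (by norm_num) (by linarith)
    positivity
  rw [h1, add_comm (∑ i ∈ Finset.Ico 1 i₀, w i), add_neg_cancel_right]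
  calc _ ≤ ∑ i ∈ Finset.Ico i₀ n, w i := by
        refine Finset.sum_le_sum fun i hi => ?_
        have hi' := (Finset.mem_Ico.1 hi).1
        have hi0 : (0 : ℝ) < i := by exact_mod_cast hi₀.trans hi'
        simp only [hw, one_div_mul_eq_div]
        exact div_le_div_of_nonneg_left (hp i hi') hi0 (by linarith)
    _ ≤ _ := by
        refine Finset.sum_le_sum_of_subset_of_nonneg
          (Finset.Ico_subset_Ico_right (Nat.le_succ n)) fun i hi _ => ?_
        exact mul_nonneg (by positivity) (hp i (Finset.mem_Ico.1 hi).1)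

theorem continuousOn_exactThreshold_mul_logb (hf : IsEnvelope f) (hF : IsSmoothedEnvelope f F) :
    ContinuousOn (fun t => 1 / t * (exactThreshold F t * Real.logb 2 (exactThreshold F t)))
      (Ioi 0) := by
  have h1 := continuousOn_exactThreshold hf hF
  have h2 : ∀ t ∈ Ioi (0 : ℝ), exactThreshold F t ≠ 0 := fun t ht =>
    (exactThreshold_pos hf hF ht).ne'
  unfold Real.logb
  exact (continuousOn_const.div continuousOn_id fun t ht => (mem_Ioi.1 ht).ne').mul
    (h1.mul ((h1.log h2).div_const _))

theorem intervalIntegrable_of_continuousOn_Ioi {g : ℝ → ℝ} (hg : ContinuousOn g (Ioi 0)) {a c : ℝ}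
    (ha : 0 < a) (hc : 0 < c) : IntervalIntegrable g volume a c :=
  (hg.mono fun _ ht => (lt_min ha hc).trans_le ht.1).intervalIntegrable

theorem asympEliasBound_integral (hf : IsEnvelope f) (hF : IsSmoothedEnvelope f F) {γ : ℝ}
    (hγ : 0 ≤ γ) (hmda : InMDA F γ) :
    AsympEliasBound f fun n => ∫ t in (1 : ℝ)..(n : ℝ),
      1 / t * (exactThreshold F t * Real.logb 2 (exactThreshold F t)) := by
  refine asympEliasBound_of_sum_le hf hF hγ hmda fun i₀ hi₀ hm₀ => ?_
  set g : ℝ → ℝ := fun t =>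
    1 / t * (exactThreshold F t * Real.logb 2 (exactThreshold F t)) with hg
  have hint : ∀ {a c : ℝ}, 0 < a → 0 < c → IntervalIntegrable g volume a c :=
    intervalIntegrable_of_continuousOn_Ioi (continuousOn_exactThreshold_mul_logb hf hF)
  have hi₀' : (0 : ℝ) < i₀ := by exact_mod_cast hi₀
  refine ⟨-∫ t in (1 : ℝ)..i₀, g t, fun n hn => ?_⟩
  have hn' : (0 : ℝ) < n := hi₀'.trans_le (by exact_mod_cast hn)
  rw [← intervalIntegral.integral_add_adjacent_intervals (hint one_pos hi₀') (hint hi₀' hn'),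
    add_neg_cancel_comm]
  have hpos : ∀ k ∈ Ico i₀ n, (0 : ℝ) < k := fun k hk => hi₀'.trans_le (by exact_mod_cast hk.1)
  rw [← intervalIntegral.sum_integral_adjacent_intervals_Ico (a := fun k : ℕ => (k : ℝ)) hn
    fun k hk => hint (hpos k hk) (by have := hpos k hk; push_cast; linarith)]
  -- On `[k, k + 1]` the numerator is at least its value at `k`, and `1 / t` is at least `1 / (k +
  -- 1)`, precisely the weight of the summand.
  refine Finset.sum_le_sum fun k hk => ?_
  have hk0 : (0 : ℝ) < k := hpos k (by simpa using hk)
  have hmk : (2 : ℝ) ≤ exactThreshold F k := hm₀.trans (exactThreshold_mono hf hF hi₀'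
    (by exact_mod_cast (Finset.mem_Ico.1 hk).1))
  have hle : (k : ℝ) ≤ (k + 1 : ℕ) := by push_cast; linarith
  have h1 := intervalIntegral.integral_mono_on hle (intervalIntegrable_const (μ := volume)
    (c := exactThreshold F k * Real.logb 2 (exactThreshold F k) / ((k : ℝ) + 1)))
    (hint hk0 (by push_cast; linarith)) ?_
  · refine le_trans ?_ h1
    simp
  · intro t ht
    push_cast at ht
    have ht0 : 0 < t := hk0.trans_le ht.1
    have hmt := exactThreshold_mono hf hF hk0 ht.1
    have h2 := mul_logb_mono (by linarith) hmt (by linarith)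
    have h3 : 0 ≤ Real.logb 2 (exactThreshold F k) := Real.logb_nonneg (by norm_num) (by linarith)
    simp only [hg, one_div_mul_eq_div]
    exact div_le_div₀ ((mul_nonneg (by linarith) h3).trans h2) h2 ht0 ht.2

theorem asympEliasBound_mul_logb (hf : IsEnvelope f) (hF : IsSmoothedEnvelope f F) {γ : ℝ}
    (hγ : 0 ≤ γ) (hmda : InMDA F γ) :
    AsympEliasBound f fun n =>
      exactThreshold F n * Real.logb 2 n * Real.logb 2 (exactThreshold F n) := by
  have hm := (tendsto_exactThreshold hf hF).comp (tendsto_natCast_atTop_atTop (R := ℝ))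
  have hm1 := hm.eventually (eventually_ge_atTop 1)
  have hnonneg : ∀ᶠ n : ℕ in atTop,
      0 ≤ exactThreshold F n * Real.logb 2 n * Real.logb 2 (exactThreshold F n) := by
    filter_upwards [hm1, eventually_ge_atTop 1] with n h1 hn
    have h2 : 0 ≤ Real.logb 2 (exactThreshold F n) := Real.logb_nonneg (by norm_num) h1
    have h3 : 0 ≤ Real.logb 2 (n : ℝ) := Real.logb_nonneg (by norm_num) (by exact_mod_cast hn)
    have h4 : (0 : ℝ) ≤ exactThreshold F n := zero_le_one.trans h1
    positivity
  refine (asympEliasBound_sum hf hF hγ hmda).mono (fun ε hε => ?_) hnonneg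
  filter_upwards [hm1, hnonneg, (Real.tendsto_log_atTop.comp
    (tendsto_natCast_atTop_atTop (R := ℝ))).eventually (eventually_ge_atTop 3)] with n h1 h0 h3
  simp only [Function.comp_apply] at h1 h3
  -- The harmonic sum is at most `1 + ln n`, while `logb 2 n` exceeds `ln n / 0.7`; the difference
  -- covers the 1 once `ln n ≥ 3`.
  have hH : ∑ i ∈ Finset.Icc 1 n, 1 / (i : ℝ) ≤ Real.logb 2 n := by
    have h4 := harmonic_le_one_add_log n
    rw [harmonic_eq_sum_Icc] at h4
    push_cast at h4
    simp only [one_div]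
    refine h4.trans ?_
    have h5 : Real.log 2 < 0.7 := Real.log_two_lt_d9.trans (by norm_num)
    rw [Real.logb, le_div_iff₀ (Real.log_pos (by norm_num))]
    nlinarith
  have hmn : 0 ≤ exactThreshold F n * Real.logb 2 (exactThreshold F n) :=
    mul_nonneg (by linarith) (Real.logb_nonneg (by norm_num) h1)
  calc ∑ i ∈ Finset.Icc 1 n, 1 / (i : ℝ) * (exactThreshold F i * Real.logb 2 (exactThreshold F i))
      ≤ ∑ i ∈ Finset.Icc 1 n,
          1 / (i : ℝ) * (exactThreshold F n * Real.logb 2 (exactThreshold F n)) := by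
        refine Finset.sum_le_sum fun i hi => ?_
        have hi0 : (0 : ℝ) < i := by exact_mod_cast (Finset.mem_Icc.1 hi).1
        exact mul_le_mul_of_nonneg_left (mul_logb_mono (exactThreshold_pos hf hF hi0)
          (exactThreshold_mono hf hF hi0 (by exact_mod_cast (Finset.mem_Icc.1 hi).2)) h1)
          (by positivity)
    _ ≤ Real.logb 2 n * (exactThreshold F n * Real.logb 2 (exactThreshold F n)) := by
        rw [← Finset.sum_mul]
        gcongr
    _ = exactThreshold F n * Real.logb 2 n * Real.logb 2 (exactThreshold F n) := by ring
    _ ≤ _ := le_mul_of_one_le_left h0 (by linarith)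

end Bounds

/-! ### Two-sided power bounds on the tail for positive index. -/

section RegularVariation

variable {f : ℕ+ → ℝ} {F : ℝ → ℝ} {γ : ℝ} {A : ℕ → ℝ}

theorem gevRate_strictAnti (hγ : 0 < γ) {x y : ℝ} (hx : 0 < 1 + γ * x) (hxy : x < y) :
    gevRate γ y < gevRate γ x := by
  rw [gevRate, gevRate, if_neg hγ.ne', if_neg hγ.ne']
  exact Real.rpow_lt_rpow_of_neg hx (by nlinarith) (div_neg_of_neg_of_pos (by norm_num) hγ)

theorem gevRate_rpow_sub_one_div (hγ : 0 < γ) {q : ℝ} (hq : 0 < q) :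
    gevRate γ ((q ^ γ - 1) / γ) = 1 / q := by
  rw [gevRate, if_neg hγ.ne', mul_div_cancel₀ _ hγ.ne', add_sub_cancel, ← Real.rpow_mul hq.le,
    mul_div_cancel₀ _ hγ.ne', Real.rpow_neg_one, one_div]

theorem continuousAt_gevRate (hγ : 0 < γ) {x : ℝ} (hx : 0 < 1 + γ * x) :
    ContinuousAt (gevRate γ) x := by
  have : gevRate γ = fun x => (1 + γ * x) ^ (-1 / γ) := by
    funext y
    rw [gevRate, if_neg hγ.ne']
  rw [this]
  exact (by fun_prop : ContinuousAt (fun x => 1 + γ * x) x).rpow_const (Or.inl hx.ne')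

/-- If `D(n) = (D(⌊n/2⌋) + a(n)) b(n)` with `a(n) → a` and `b(n) → b < 1`, then `D` is eventually
below any number above the fixed point. -/
theorem eventually_le_of_halving {D a b : ℕ → ℝ} {a₀ b₀ L : ℝ}
    (hD : ∀ᶠ n in atTop, 0 ≤ D n) (ha : Tendsto a atTop (𝓝 a₀)) (hb : Tendsto b atTop (𝓝 b₀))
    (hb0 : 0 < b₀) (hb1 : b₀ < 1) (hL : a₀ * b₀ / (1 - b₀) < L)
    (h : ∀ᶠ n in atTop, D n = (D (n / 2) + a n) * b n) : ∀ᶠ n in atTop, D n ≤ L := by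
  -- Choose `η` so that the recursion with both limits enlarged by `η` still has its fixed point
  -- `L₀` below `L`; iterating it contracts the excess over `L₀` by `θ < 1` at each halving.
  have hcont : Tendsto (fun η : ℝ => (a₀ * b₀ + η) / (1 - (b₀ + η)))
      (𝓝[>] 0) (𝓝 (a₀ * b₀ / (1 - b₀))) := by
    have : ContinuousAt (fun η : ℝ => (a₀ * b₀ + η) / (1 - (b₀ + η))) 0 := by
      refine ContinuousAt.div (by fun_prop) (by fun_prop) ?_
      simpa using (sub_pos.2 hb1).ne'
    simpa using this.tendsto.mono_left nhdsWithin_le_nhds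
  obtain ⟨η, ⟨hη1, hη2⟩, hη0⟩ := ((hcont.eventually (gt_mem_nhds hL)).and
    (nhdsWithin_le_nhds (gt_mem_nhds (show (0 : ℝ) < 1 - b₀ by linarith)))).and
    self_mem_nhdsWithin |>.exists
  replace hη0 : 0 < η := hη0
  set θ := b₀ + η with hθ
  set κ := a₀ * b₀ + η with hκ
  have hθ1 : 0 < 1 - θ := by linarith
  have hhalf : Tendsto (fun n : ℕ => n / 2) atTop atTop := Nat.tendsto_div_const_atTop (by norm_num)
  have hrec : ∀ᶠ n in atTop, D n ≤ θ * D (n / 2) + κ := by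
    filter_upwards [h, hhalf.eventually hD, hb.eventually (gt_mem_nhds (show b₀ < θ by linarith)),
      (ha.mul hb).eventually (gt_mem_nhds (show a₀ * b₀ < κ by linarith))] with n h1 h2 h3 h4
    rw [h1, add_mul, mul_comm (D (n / 2))]
    exact add_le_add (mul_le_mul_of_nonneg_right h3.le h2) h4.le
  obtain ⟨N, hN⟩ := eventually_atTop.1 (hrec.and (eventually_ge_atTop 1))
  set L₀ := κ / (1 - θ) with hL₀
  have hfix : θ * L₀ + κ = L₀ := by
    rw [hL₀]
    field_simp
    ring
  obtain ⟨C, hC0, hC⟩ : ∃ C, 0 ≤ C ∧ ∀ n < N, D n - L₀ ≤ C := by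
    refine ⟨∑ n ∈ Finset.range N, |D n - L₀|, Finset.sum_nonneg fun _ _ => abs_nonneg _,
      fun n hn => (le_abs_self _).trans ?_⟩
    exact Finset.single_le_sum (f := fun n => |D n - L₀|) (fun _ _ => abs_nonneg _)
      (Finset.mem_range.2 hn)
  have hθ0 : 0 < θ := by linarith
  have hbound : ∀ n, D n - L₀ ≤ C := by
    intro n
    induction n using Nat.strong_induction_on with
    | _ n ih =>
      rcases lt_or_ge n N with hn | hn
      · exact hC n hn
      · obtain ⟨h1, h2⟩ := hN n hn
        have h3 := mul_le_mul_of_nonneg_left (ih (n / 2) (by omega)) hθ0.le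
        nlinarith
  have hiter : ∀ k : ℕ, ∀ᶠ n in atTop, D n - L₀ ≤ θ ^ k * C := by
    intro k
    induction k with
    | zero => exact Eventually.of_forall fun n => by simpa using hbound n
    | succ k ih =>
      filter_upwards [hrec, hhalf.eventually ih] with n h1 h2
      have h3 := mul_le_mul_of_nonneg_left h2 hθ0.le
      rw [pow_succ', mul_assoc]
      linarith
  have hlim : Tendsto (fun k : ℕ => θ ^ k * C) atTop (𝓝 0) := by
    simpa using (tendsto_pow_atTop_nhds_zero_of_lt_one hθ0.le (by linarith)).mul_const C
  obtain ⟨k, hk⟩ := (hlim.eventually (gt_mem_nhds (show 0 < L - L₀ by linarith))).exists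
  filter_upwards [hiter k] with n hn
  linarith

variable (hf : IsEnvelope f) (hF : IsSmoothedEnvelope f F)

section

variable (h : ∀ x, 0 < 1 + γ * x →
    Tendsto (fun n : ℕ => F (A n * x + quantile F n) ^ n) atTop (𝓝 (gev γ x)))

include hf hF h

/-- For `d < 1/γ` one has `l U(n) ≥ U(n) + A n * ((l - 1) d)` eventually, and the limiting rate
there tends to `l ^ (-1/γ)` as `d` approaches `1/γ`. -/
theorem eventually_compl_le_rpow_mul_of_mda (hγ : 0 < γ) {l β : ℝ} (hl : 1 < l) (hβ : β < 1 / γ) :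
    ∀ᶠ y in atTop, 1 - F (l * y) ≤ l ^ (-β) * (1 - F y) := by
  have hx0 : (l - 1) * (1 / γ) = ((l ^ (1 / γ)) ^ γ - 1) / γ := by
    rw [← Real.rpow_mul (by linarith), one_div_mul_cancel hγ.ne', Real.rpow_one]
    ring
  have hrate : gevRate γ ((l - 1) * (1 / γ)) = l ^ (-(1 / γ)) := by
    rw [hx0, gevRate_rpow_sub_one_div hγ (by positivity), Real.rpow_neg (by linarith), one_div]
  have hlt : gevRate γ ((l - 1) * (1 / γ)) < l ^ (-β) := by
    rw [hrate]
    exact Real.rpow_lt_rpow_of_exponent_lt hl (by linarith)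
  have hcont : ContinuousAt (fun d => gevRate γ ((l - 1) * d)) (1 / γ) := by
    refine ContinuousAt.comp (g := gevRate γ) (continuousAt_gevRate hγ ?_) (by fun_prop)
    have : 0 < (l - 1) * (1 / γ) := mul_pos (by linarith) (by positivity)
    positivity
  obtain ⟨d, ⟨hd1, hd0⟩, hd2⟩ := ((eventually_nhdsWithin_of_eventually_nhds (s := Iio (1 / γ))
    ((hcont.eventually (gt_mem_nhds hlt)).and
      (lt_mem_nhds (show 0 < 1 / γ by positivity)))).and eventually_mem_nhdsWithin).exists
  simp only [mem_Iio] at hd2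
  have hpos : 0 < 1 + γ * ((l - 1) * d) := by
    have : 0 < (l - 1) * d := mul_pos (by linarith) hd0
    positivity
  have hgd : γ * d < 1 := by
    rw [lt_div_iff₀ hγ] at hd2
    linarith
  obtain ⟨c, hc1, hc2⟩ := exists_between hd1
  have hc0 : 0 < c := (gevRate_nonneg hpos).trans_lt hc1
  refine eventually_compl_le_of_quantile hf hF (by linarith) hc0 hc2 ?_
  filter_upwards [(tendsto_mul_compl_of_mda hf hF h hpos).eventually (gt_mem_nhds hc1),
    eventually_mul_le_quantile_of_mda hf hF h hgd] with n h1 h2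
  have h3 : A n * ((l - 1) * d) + quantile F n ≤ l * quantile F n := by nlinarith
  have h4 := hF.mono h3
  have : (0 : ℝ) ≤ n := by positivity
  nlinarith

variable (hA : ∀ n, 0 < A n)

include hA

/-- The normalized increments of the quantile function converge. -/
theorem tendsto_quantile_sub_div (hγ : 0 < γ) {q : ℝ} (hq : 1 < q) {p N : ℕ → ℕ}
    (hp : Tendsto p atTop atTop) (hN : ∀ᶠ n in atTop, 1 ≤ N n)
    (hpN : Tendsto (fun n => (p n : ℝ) / N n) atTop (𝓝 (1 / q))) :
    Tendsto (fun n => (quantile F (N n) - quantile F (p n)) / A (p n)) atTop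
      (𝓝 ((q ^ γ - 1) / γ)) := by
  set X := (q ^ γ - 1) / γ with hX
  have hX0 : 0 < X := div_pos (sub_pos.2 (Real.one_lt_rpow hq hγ)) hγ
  have hrate : gevRate γ X = 1 / q := gevRate_rpow_sub_one_div hγ (by linarith)
  -- The tail at `U(N n)` is exactly `1 / N n`, so comparing `p / N → 1/q` with the limiting rate at
  -- a level `x` places `U(N n)` relative to `A (p n) * x + U(p n)`.
  have hcompl : ∀ n, 1 ≤ N n → (p n : ℝ) / N n = p n * (1 - F (quantile F (N n))) := by
    intro n hn
    rw [compl_quantile hf hF (by exact_mod_cast hn), mul_one_div]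
  refine tendsto_order.2 ⟨fun a ha => ?_, fun b hb => ?_⟩
  · have ha' : max a 0 < X := max_lt ha hX0
    have hpos : 0 < 1 + γ * max a 0 := by positivity
    have h1 := (tendsto_mul_compl_of_mda hf hF h hpos).comp hp
    have h2 := hrate ▸ gevRate_strictAnti hγ hpos ha'
    filter_upwards [hN, hpN.eventually_lt h1 h2] with n h3 h4
    simp only [Function.comp_apply, hcompl n h3] at h4
    have h5 := lt_of_mul_lt_mul_left h4 (Nat.cast_nonneg _)
    have h6 : A (p n) * max a 0 + quantile F (p n) < quantile F (N n) := by
      by_contra! hle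
      linarith [hF.mono hle]
    rw [lt_div_iff₀ (hA _), mul_comm]
    nlinarith [mul_le_mul_of_nonneg_left (le_max_left a 0) (hA (p n)).le]
  · have hpos : 0 < 1 + γ * b := by nlinarith
    have h1 := (tendsto_mul_compl_of_mda hf hF h hpos).comp hp
    have h2 := hrate ▸ gevRate_strictAnti hγ (by positivity) hb
    filter_upwards [hN, h1.eventually_lt hpN h2] with n h3 h4
    simp only [Function.comp_apply, hcompl n h3] at h4
    have h5 := lt_of_mul_lt_mul_left h4 (Nat.cast_nonneg _)
    have h6 : quantile F (N n) < A (p n) * b + quantile F (p n) := by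
      by_contra! hle
      linarith [hF.mono hle]
    rw [div_lt_iff₀ (hA _), mul_comm b]
    linarith

/-- The quotient `D(n) = U(n) / A n` satisfies `D(n) = (D(n/2) + a(n)) b(n)` with `a(n) = (U(n) -
U(n/2)) / A(n/2) → (2 ^ γ - 1) / γ` and `b(n) = A(n/2) / A(n) → 2 ^ (-γ)`. The fixed point of the
limiting recursion is `1/γ`. -/
theorem eventually_quantile_le_mul (hγ : 0 < γ) {L : ℝ} (hL : 1 / γ < L) :
    ∀ᶠ n : ℕ in atTop, quantile F n ≤ L * A n := by
  have hhalf : Tendsto (fun n : ℕ => n / 2) atTop atTop := Nat.tendsto_div_const_atTop (by norm_num)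
  have hratio : Tendsto (fun n : ℕ => ((n / 2 : ℕ) : ℝ) / n) atTop (𝓝 (1 / 2)) := by
    have h1 : Tendsto (fun n : ℕ => (1 : ℝ) / 2 - 1 / n) atTop (𝓝 (1 / 2)) := by
      simpa using tendsto_one_div_atTop_nhds_zero_nat.const_sub ((1 : ℝ) / 2)
    refine tendsto_of_tendsto_of_tendsto_of_le_of_le' h1 tendsto_const_nhds ?_ ?_
    · filter_upwards [eventually_ge_atTop 1] with n hn
      have hn0 : (0 : ℝ) < n := by exact_mod_cast hn
      rw [le_div_iff₀ hn0, sub_mul, one_div_mul_cancel hn0.ne']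
      have : n ≤ 2 * (n / 2) + 1 := by omega
      have : (n : ℝ) ≤ 2 * ((n / 2 : ℕ) : ℝ) + 1 := by exact_mod_cast this
      linarith
    · filter_upwards [eventually_ge_atTop 1] with n hn
      have hn0 : (0 : ℝ) < n := by exact_mod_cast hn
      rw [div_le_iff₀ hn0]
      have : 2 * (n / 2) ≤ n := by omega
      have : 2 * ((n / 2 : ℕ) : ℝ) ≤ n := by exact_mod_cast this
      linarith
  have h2γ : (1 : ℝ) < 2 ^ γ := Real.one_lt_rpow (by norm_num) hγ
  have h4γ : (4 : ℝ) ^ γ = 2 ^ γ * 2 ^ γ := by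
    rw [← Real.mul_rpow (by norm_num) (by norm_num)]
    norm_num
  have hN1 : ∀ᶠ n : ℕ in atTop, 1 ≤ n := eventually_ge_atTop 1
  have hN2 : ∀ᶠ n : ℕ in atTop, 1 ≤ 2 * n := by filter_upwards [hN1] with n hn; omega
  have l1 := tendsto_quantile_sub_div hf hF h hA hγ (q := 2) (by norm_num) hhalf hN1 hratio
  have l2 := tendsto_quantile_sub_div hf hF h hA hγ (q := 4) (by norm_num) hhalf hN2 (by
    convert hratio.div_const 2 using 2
    · push_cast
      rw [div_div, mul_comm]
    · norm_num)
  have l3 := tendsto_quantile_sub_div hf hF h hA hγ (q := 2) (by norm_num) tendsto_id hN2 (by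
    refine tendsto_const_nhds.congr' ?_
    filter_upwards [hN1] with n hn
    have hn0 : (n : ℝ) ≠ 0 := by positivity
    push_cast
    rw [id, div_eq_div_iff (by norm_num) (by positivity)]
    ring)
  have hX2 : 0 < ((2 : ℝ) ^ γ - 1) / γ := div_pos (by linarith) hγ
  -- Measure the increment `U(2n) - U(n)` in units of `A n` and, as a difference of increments from
  -- `n / 2`, in units of `A (n / 2)`; the quotient of the two is the ratio sought.
  have hb : Tendsto (fun n : ℕ => A (n / 2) / A n) atTop (𝓝 (2 ^ γ)⁻¹) := by
    have h5 := l3.div (l2.sub l1) (by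
      rw [h4γ, ← sub_div]
      have : (2 : ℝ) ^ γ * 2 ^ γ - 1 - (2 ^ γ - 1) = 2 ^ γ * (2 ^ γ - 1) := by ring
      rw [this]
      have : 0 < (2 : ℝ) ^ γ - 1 := by linarith
      positivity)
    have h6 : ((2 : ℝ) ^ γ - 1) / γ / (((4 : ℝ) ^ γ - 1) / γ - ((2 : ℝ) ^ γ - 1) / γ) =
        (2 ^ γ)⁻¹ := by
      rw [h4γ]
      have h7 : (2 : ℝ) ^ γ - 1 ≠ 0 := by linarith
      have h8 : ((2 : ℝ) ^ γ * 2 ^ γ - 1) / γ - ((2 : ℝ) ^ γ - 1) / γ =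
        2 ^ γ * ((2 ^ γ - 1) / γ) := by ring
      rw [h8, div_mul_cancel_right₀ hX2.ne']
    rw [h6] at h5
    refine h5.congr' ?_
    filter_upwards [l3.eventually (lt_mem_nhds hX2)] with n h7
    have ha := hA n
    have ha' := hA (n / 2)
    simp only [id, Pi.div_apply] at h7 ⊢
    have h8 : quantile F ((2 * n : ℕ) : ℝ) - quantile F n ≠ 0 := by
      intro h0
      rw [h0, zero_div] at h7
      exact h7.false
    rw [← sub_div, sub_sub_sub_cancel_right]
    field_simp
  have hD := eventually_le_of_halving (D := fun n : ℕ => quantile F n / A n)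
    (L := L) (b₀ := (2 ^ γ)⁻¹) ?_ l1 hb (by positivity) (inv_lt_one_of_one_lt₀ h2γ) ?_ ?_
  · filter_upwards [hD] with n hn
    rwa [div_le_iff₀ (hA n)] at hn
  · filter_upwards [((tendsto_quantile hf hF).comp
      (tendsto_natCast_atTop_atTop (R := ℝ))).eventually (eventually_ge_atTop 0)] with n hn
    exact div_nonneg hn (hA n).le
  · convert hL using 1
    have h7 : (2 : ℝ) ^ γ - 1 ≠ 0 := by linarith
    field_simp
  · refine Eventually.of_forall fun n => ?_
    have ha := hA n
    have ha' := hA (n / 2)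
    field_simp
    ring

/-- This is the reverse estimate: `U(n) ≤ L A n` for `L > 1/γ` gives `l U(n) ≤ U(n) + A n * ((l - 1)
L)`, and `L` is taken close to `1/γ`. -/
theorem eventually_rpow_mul_compl_le_of_mda (hγ : 0 < γ) {l β : ℝ} (hl : 1 < l) (hβ : 1 / γ < β) :
    ∀ᶠ y in atTop, l ^ (-β) * (1 - F y) ≤ 1 - F (l * y) := by
  have hx0 : (l - 1) * (1 / γ) = ((l ^ (1 / γ)) ^ γ - 1) / γ := by
    rw [← Real.rpow_mul (by linarith), one_div_mul_cancel hγ.ne', Real.rpow_one]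
    ring
  have hrate : gevRate γ ((l - 1) * (1 / γ)) = l ^ (-(1 / γ)) := by
    rw [hx0, gevRate_rpow_sub_one_div hγ (by positivity), Real.rpow_neg (by linarith), one_div]
  have hlt : l ^ (-β) < gevRate γ ((l - 1) * (1 / γ)) := by
    rw [hrate]
    exact Real.rpow_lt_rpow_of_exponent_lt hl (by linarith)
  have hcont : ContinuousAt (fun L => gevRate γ ((l - 1) * L)) (1 / γ) := by
    refine ContinuousAt.comp (g := gevRate γ) (continuousAt_gevRate hγ ?_) (by fun_prop)
    have : 0 < (l - 1) * (1 / γ) := mul_pos (by linarith) (by positivity)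
    positivity
  obtain ⟨L, hL1, hL2⟩ := ((eventually_nhdsWithin_of_eventually_nhds (s := Ioi (1 / γ))
    (hcont.eventually (lt_mem_nhds hlt))).and eventually_mem_nhdsWithin).exists
  simp only [mem_Ioi] at hL2
  have hL0 : 0 < L := lt_trans (by positivity) hL2
  have hpos : 0 < 1 + γ * ((l - 1) * L) := by
    have : 0 < (l - 1) * L := mul_pos (by linarith) hL0
    positivity
  obtain ⟨c, hc1, hc2⟩ := exists_between hL1
  have hquant : ∀ᶠ n : ℕ in atTop, c ≤ n * (1 - F (l * quantile F n)) := by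
    filter_upwards [(tendsto_mul_compl_of_mda hf hF h hpos).eventually (lt_mem_nhds hc2),
      eventually_quantile_le_mul hf hF h hA hγ hL2] with n h1 h2
    have h3 : l * quantile F n ≤ A n * ((l - 1) * L) + quantile F n := by nlinarith
    have h4 := hF.mono h3
    have : (0 : ℝ) ≤ n := by positivity
    nlinarith
  have hl0 : 0 < l ^ (-β) := Real.rpow_pos_of_pos (by linarith) _
  have h1 : Tendsto (fun n : ℕ => l ^ (-β) * (1 + 1 / (n : ℝ))) atTop (𝓝 (l ^ (-β))) := by
    simpa using (tendsto_one_div_atTop_nhds_zero_nat.const_add (1 : ℝ)).const_mul (l ^ (-β))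
  obtain ⟨N, hN⟩ := eventually_atTop.1 (hquant.and (h1.eventually (gt_mem_nhds hc1)))
  filter_upwards [eventually_exists_quantile_bracket hf hF N] with y ⟨n, hNn, hn1, _, hq, _, hhi⟩
  have hn : (0 : ℝ) < n := by exact_mod_cast hn1
  have h2 := (hN n hNn).2
  have h3 := (hN (n + 1) (by omega)).1
  push_cast at h3 hq
  have h4 := hF.mono (mul_le_mul_of_nonneg_left hq (show 0 ≤ l by linarith))
  have h5 : l ^ (-β) * (1 - F y) ≤ l ^ (-β) * (1 / n) := by gcongr
  have h6 : l ^ (-β) * (1 / n) ≤ c / (n + 1) := by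
    rw [mul_one_div, div_le_div_iff₀ hn (by linarith)]
    have : l ^ (-β) * (1 + 1 / (n : ℝ)) * n = l ^ (-β) * (n + 1) := by field_simp
    nlinarith
  have h7 : c / ((n : ℝ) + 1) ≤ 1 - F (l * quantile F ((n : ℝ) + 1)) := by
    rw [div_le_iff₀ (by linarith)]
    linarith
  linarith

end

end RegularVariation

/-! ### The sharper bound for positive index. -/

section PositiveIndex

variable {f : ℕ+ → ℝ} {F : ℝ → ℝ} {γ : ℝ}

/-- A power bound on the tail bounds the logarithm of the exact threshold. -/
theorem exists_mul_logb_exactThreshold_le (hf : IsEnvelope f) (hF : IsSmoothedEnvelope f F) {β : ℝ}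
    (hβ : 0 ≤ β) (h : ∀ᶠ y in atTop, 1 - F (2 * y) ≤ 2 ^ (-β) * (1 - F y)) :
    ∃ C, ∀ᶠ t in atTop, (1 + β) * Real.logb 2 (exactThreshold F t) ≤ Real.logb 2 t + C := by
  obtain ⟨Y₀, hY₀⟩ := eventually_atTop.1 h
  set Y := max Y₀ 1 with hYdef
  have hY1 : 1 ≤ Y := le_max_right _ _
  have hY0 : 0 < Y := by linarith
  refine ⟨β * (Real.logb 2 Y + 1), ?_⟩
  filter_upwards [eventually_gt_atTop 0,
    (tendsto_exactThreshold hf hF).eventually (eventually_ge_atTop Y)] with t ht hm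
  have hspec := exactThreshold_spec hf hF ht
  set m := exactThreshold F t
  have hm0 : 0 < m := by linarith
  -- With `2 ^ k Y ≤ m < 2 ^ (k + 1) Y`, iterating the tail bound gives `m / t ≤ 2 ^ (-β k)`, and
  -- `k` exceeds `log m - log Y - 1`.
  obtain ⟨k, hk1, hk2⟩ := exists_nat_pow_near ((one_le_div hY0).2 hm) (one_lt_two (α := ℝ))
  rw [le_div_iff₀ hY0] at hk1
  rw [div_lt_iff₀ hY0] at hk2
  have h1 := compl_two_pow_mul_le (Real.rpow_nonneg (by norm_num : (0 : ℝ) ≤ 2) (-β)) hY0.le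
    (fun y hy => hY₀ y ((le_max_left _ _).trans hy)) le_rfl k
  have h2 := hF.mono hk1
  have h3 : ((2 : ℝ) ^ (-β)) ^ k * (1 - F Y) ≤ ((2 : ℝ) ^ (-β)) ^ k := by
    refine mul_le_of_le_one_right (by positivity) ?_
    linarith [hF.nonneg hf Y]
  have h4 : m / t ≤ ((2 : ℝ) ^ (-β)) ^ k := by linarith
  have h5 := Real.logb_le_logb_of_le one_lt_two (by positivity) h4
  rw [Real.logb_div hm0.ne' ht.ne', Real.logb_pow, Real.logb_rpow (by norm_num) (by norm_num)] at h5
  have h6 := Real.logb_le_logb_of_le one_lt_two hm0 hk2.le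
  rw [Real.logb_mul (by positivity) hY0.ne', Real.logb_pow,
    Real.logb_self_eq_one (by norm_num)] at h6
  push_cast at h6
  nlinarith

theorem continuousOn_exactThreshold_div (hf : IsEnvelope f) (hF : IsSmoothedEnvelope f F) :
    ContinuousOn (fun t => exactThreshold F t / t) (Ioi 0) :=
  (continuousOn_exactThreshold hf hF).div continuousOn_id fun _ ht => (mem_Ioi.1 ht).ne'

/-- If `m(κ t) ≥ l m(t)` eventually, then `∫₁ᵀ m(t)/t dt` is at most `(κ - 1) / (l - 1) m(T)` up to
an additive constant. -/
theorem exists_integral_exactThreshold_div_le (hf : IsEnvelope f) (hF : IsSmoothedEnvelope f F)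
    {l κ : ℝ} (hl : 1 < l) (hκ : 1 < κ)
    (h : ∀ᶠ t in atTop, l * exactThreshold F t ≤ exactThreshold F (κ * t)) :
    ∃ C, ∀ᶠ T in atTop, ∫ t in (1 : ℝ)..T, exactThreshold F t / t ≤
      (κ - 1) / (l - 1) * exactThreshold F T + C := by
  obtain ⟨t₁, ht₁⟩ := eventually_atTop.1 h
  set t₀ := max t₁ 1 with ht₀
  have ht₀1 : 1 ≤ t₀ := le_max_right _ _
  set g : ℝ → ℝ := fun t => exactThreshold F t / t with hg
  have hcont : ContinuousOn g (Ioi 0) := continuousOn_exactThreshold_div hf hF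
  have hint : ∀ {a c : ℝ}, 0 < a → 0 < c → IntervalIntegrable g volume a c :=
    intervalIntegrable_of_continuousOn_Ioi hcont
  have hg0 : ∀ t, 0 < t → 0 ≤ g t := fun t ht =>
    div_nonneg (exactThreshold_pos hf hF ht).le ht.le
  set C₀ := ∫ t in (1 : ℝ)..t₀, g t with hC₀
  refine ⟨l * C₀ / (l - 1), ?_⟩
  filter_upwards [eventually_ge_atTop t₀] with T hT
  have hT0 : 0 < T := by linarith
  have ht00 : 0 < t₀ := by linarith
  have hκ0 : 0 < κ := by linarith
  -- After the substitution `s = κ t`, growth of the threshold multiplies the integral by at least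
  -- `l`. The range gained beyond `T` contributes at most `(κ - 1) m(T)`, since `m(t) / t` is
  -- nonincreasing; solving for the integral gives the claim.
  have hscale : l * ∫ t in t₀..T, g t ≤ ∫ s in (κ * t₀)..(κ * T), g s := by
    have h1 : ∫ s in (κ * t₀)..(κ * T), g s = κ * ∫ t in t₀..T, g (κ * t) := by
      rw [intervalIntegral.integral_comp_mul_left _ hκ0.ne', smul_eq_mul,
        mul_inv_cancel_left₀ hκ0.ne']
    rw [h1, ← intervalIntegral.integral_const_mul, ← intervalIntegral.integral_const_mul]
    refine intervalIntegral.integral_mono_on hT ((hint ht00 hT0).const_mul l) ?_ fun t ht => ?_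
    · refine IntervalIntegrable.const_mul ?_ κ
      refine intervalIntegrable_of_continuousOn_Ioi ?_ ht00 hT0
      exact hcont.comp (by fun_prop) fun t ht => mul_pos hκ0 ht
    · have ht0 : 0 < t := ht00.trans_le ht.1
      have h2 := ht₁ t ((le_max_left _ _).trans ht.1)
      have h3 : κ * g (κ * t) = exactThreshold F (κ * t) / t := by
        simp only [hg]
        field_simp
      rw [h3]
      simp only [hg]
      rw [← mul_div_assoc]
      gcongr
  have hκt₀ : 0 < κ * t₀ := by positivity
  have hκT : 0 < κ * T := by positivity
  have e1 : C₀ + ∫ t in t₀..T, g t = ∫ t in (1 : ℝ)..T, g t :=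
    intervalIntegral.integral_add_adjacent_intervals (hint one_pos ht00) (hint ht00 hT0)
  have e2 : (∫ t in (1 : ℝ)..T, g t) + ∫ t in T..(κ * T), g t = ∫ t in (1 : ℝ)..(κ * T), g t :=
    intervalIntegral.integral_add_adjacent_intervals (hint one_pos hT0) (hint hT0 hκT)
  have e3 : (∫ t in (1 : ℝ)..(κ * t₀), g t) + ∫ t in (κ * t₀)..(κ * T), g t =
      ∫ t in (1 : ℝ)..(κ * T), g t :=
    intervalIntegral.integral_add_adjacent_intervals (hint one_pos hκt₀) (hint hκt₀ hκT)
  have e4 : 0 ≤ ∫ t in (1 : ℝ)..(κ * t₀), g t :=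
    intervalIntegral.integral_nonneg (by nlinarith) fun t ht => hg0 t (by linarith [ht.1])
  have hTκ : T ≤ κ * T := le_mul_of_one_le_left hT0.le hκ.le
  have e5 : ∫ t in T..(κ * T), g t ≤ (κ - 1) * exactThreshold F T := by
    have h1 := intervalIntegral.integral_mono_on hTκ (hint hT0 hκT)
      (intervalIntegrable_const (μ := volume) (c := exactThreshold F T / T))
      fun t ht => exactThreshold_div_anti hf hF hT0 ht.1
    refine h1.trans_eq ?_
    rw [intervalIntegral.integral_const, smul_eq_mul]
    field_simp
  have hl1 : 0 < l - 1 := by linarith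
  rw [div_mul_eq_mul_div, ← add_div, le_div_iff₀ hl1]
  nlinarith

/-- At `l m(t)` the tail is at least `l ^ (-β) m(t) / t = l m(t) / (l ^ (1 + β) t)`, so this point
does not exceed the threshold at `l ^ (1 + β) t`. -/
theorem eventually_mul_exactThreshold_le (hf : IsEnvelope f) (hF : IsSmoothedEnvelope f F)
    {l β : ℝ} (hl : 1 < l) (h : ∀ᶠ y in atTop, l ^ (-β) * (1 - F y) ≤ 1 - F (l * y)) :
    ∀ᶠ t in atTop, l * exactThreshold F t ≤ exactThreshold F (l ^ (1 + β) * t) := by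
  have hl0 : 0 < l := by linarith
  filter_upwards [(tendsto_exactThreshold hf hF).eventually h, eventually_gt_atTop 0] with t h1 ht
  rw [le_exactThreshold_iff hf hF (by positivity)]
  rw [exactThreshold_spec hf hF ht] at h1
  refine le_trans (le_of_eq ?_) h1
  rw [Real.rpow_add hl0, Real.rpow_one, Real.rpow_neg hl0.le]
  field_simp

/-- The derivative of `x ^ a` at 1 is `a`. With `a = 1 + β` this brings the constant `(κ - 1) / (l -
1)` for `κ = l ^ (1 + β)` close to `1 + β`. -/
theorem exists_rpow_sub_one_le {a c : ℝ} (hac : a < c) :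
    ∃ l : ℝ, 1 < l ∧ l ^ a - 1 ≤ c * (l - 1) := by
  have hd : HasDerivAt (fun x : ℝ => x ^ a) a 1 := by
    simpa using Real.hasDerivAt_rpow_const (x := 1) (p := a) (Or.inl one_ne_zero)
  have hs := (hasDerivAt_iff_tendsto_slope.1 hd).mono_left
    (nhdsWithin_mono 1 (show Ioi (1 : ℝ) ⊆ {1}ᶜ from fun x hx => (mem_Ioi.1 hx).ne'))
  obtain ⟨l, h1, h2⟩ := ((hs.eventually (gt_mem_nhds hac)).and eventually_mem_nhdsWithin).exists
  have h2' : 0 < l - 1 := sub_pos.2 h2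
  refine ⟨l, h2, ?_⟩
  rw [slope_def_field, Real.one_rpow, div_lt_iff₀ h2'] at h1
  exact h1.le

theorem asympEliasBound_mul_logb_of_pos (hf : IsEnvelope f) (hF : IsSmoothedEnvelope f F)
    (hγ : 0 < γ) (hmda : InMDA F γ) :
    AsympEliasBound f fun n => exactThreshold F n * Real.logb 2 n := by
  have hcast := tendsto_natCast_atTop_atTop (R := ℝ)
  have hm := (tendsto_exactThreshold hf hF).comp hcast
  have hlog := (Real.tendsto_logb_atTop (b := 2) (by norm_num)).comp hcast
  refine (asympEliasBound_integral hf hF hγ.le hmda).mono (fun ε hε => ?_) ?_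
  · obtain ⟨A, hA, h⟩ := hmda
    have hα : 0 < 1 / γ := by positivity
    set α := 1 / γ with hαdef
    -- The total loss will be `(1 + δ) ^ 3 / (1 - δ)`: two factors `1 + δ` from the integral of
    -- `m(t) / t`, and `(1 + δ) / (1 - δ)` from `log m`. The last condition keeps the exponent `β'`
    -- nonnegative.
    obtain ⟨δ, ⟨⟨hδε, hδ1⟩, hδα⟩, hδ0⟩ : ∃ δ : ℝ,
        (((1 + δ) ^ 3 / (1 - δ) < 1 + ε ∧ δ < 1) ∧ δ * (1 + α) < α) ∧ 0 < δ := by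
      have h1 : ContinuousAt (fun δ : ℝ => (1 + δ) ^ 3 / (1 - δ)) 0 :=
        ContinuousAt.div (by fun_prop) (by fun_prop) (by norm_num)
      have h2 : ∀ᶠ δ in 𝓝 (0 : ℝ), (1 + δ) ^ 3 / (1 - δ) < 1 + ε :=
        h1.eventually (gt_mem_nhds (by simpa using hε))
      have h3 : ∀ᶠ δ in 𝓝 (0 : ℝ), δ < 1 := gt_mem_nhds one_pos
      have h4 : ∀ᶠ δ in 𝓝 (0 : ℝ), δ * (1 + α) < α :=
        (show ContinuousAt (fun δ : ℝ => δ * (1 + α)) 0 by fun_prop).eventually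
          (gt_mem_nhds (by simpa using hα))
      exact ((eventually_nhdsWithin_of_eventually_nhds (s := Ioi (0 : ℝ))
        ((h2.and h3).and h4)).and eventually_mem_nhdsWithin).exists
    have hα1 : 0 < 1 + α := by positivity
    obtain ⟨l, hl, hlc⟩ := exists_rpow_sub_one_le
      (show (1 + α) * (1 + δ / 2) < (1 + α) * (1 + δ) by gcongr; linarith)
    set β := (1 + α) * (1 + δ / 2) - 1 with hβ
    have hβα : α < β := by nlinarith
    have hκ : 1 < l ^ (1 + β) := Real.one_lt_rpow hl (by linarith)
    have hslope : (l ^ (1 + β) - 1) / (l - 1) ≤ (1 + α) * (1 + δ) := by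
      rw [div_le_iff₀ (by linarith), hβ, add_sub_cancel]
      exact hlc
    obtain ⟨C₁, hC₁⟩ := exists_integral_exactThreshold_div_le hf hF hl hκ
      (eventually_mul_exactThreshold_le hf hF hl
        (eventually_rpow_mul_compl_le_of_mda hf hF h hA hγ hl hβα))
    set β' := (1 + α) * (1 - δ) - 1 with hβ'
    have hβ'0 : 0 ≤ β' := by linarith
    have hβ'α : β' < α := by nlinarith
    obtain ⟨C₂, hC₂⟩ := exists_mul_logb_exactThreshold_le hf hF hβ'0
      (eventually_compl_le_rpow_mul_of_mda hf hF h hγ one_lt_two hβ'α)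
    filter_upwards [eventually_ge_atTop 1, hcast.eventually hC₁, hcast.eventually hC₂,
      hm.eventually (eventually_ge_atTop 1),
      hm.eventually (eventually_ge_atTop (C₁ / ((1 + α) * (1 + δ) * δ))),
      hlog.eventually (eventually_ge_atTop (C₂ / δ)),
      hlog.eventually (eventually_ge_atTop 0)] with n hn hJ hL hm1 hmC hlC hl0
    simp only [Function.comp_apply] at hm1 hmC hlC hl0
    have hn0 : (1 : ℝ) ≤ n := by exact_mod_cast hn
    set m := exactThreshold F n with hmdef
    have hlogm : 0 ≤ Real.logb 2 m := Real.logb_nonneg (by norm_num) hm1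
    have hint : ∫ t in (1 : ℝ)..n, 1 / t * (exactThreshold F t * Real.logb 2 (exactThreshold F t)) ≤
        Real.logb 2 m * ∫ t in (1 : ℝ)..n, exactThreshold F t / t := by
      rw [← intervalIntegral.integral_const_mul]
      refine intervalIntegral.integral_mono_on hn0
        (intervalIntegrable_of_continuousOn_Ioi (continuousOn_exactThreshold_mul_logb hf hF) one_pos
          (by linarith))
        ((intervalIntegrable_of_continuousOn_Ioi (continuousOn_exactThreshold_div hf hF) one_pos
          (by linarith)).const_mul _) fun t ht => ?_
      have ht0 : 0 < t := by linarith [ht.1]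
      have hmt := exactThreshold_pos hf hF ht0
      have h1 : Real.logb 2 (exactThreshold F t) ≤ Real.logb 2 m :=
        Real.logb_le_logb_of_le (by norm_num) hmt (exactThreshold_mono hf hF ht0 ht.2)
      calc _ = Real.logb 2 (exactThreshold F t) * (exactThreshold F t / t) := by ring
        _ ≤ _ := by gcongr
    have hJ' : ∫ t in (1 : ℝ)..n, exactThreshold F t / t ≤ (1 + α) * (1 + δ) ^ 2 * m := by
      rw [div_le_iff₀ (by positivity)] at hmC
      have : (l ^ (1 + β) - 1) / (l - 1) * m ≤ (1 + α) * (1 + δ) * m := by gcongr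
      calc _ ≤ _ := hJ
        _ ≤ (1 + α) * (1 + δ) * m + m * ((1 + α) * (1 + δ) * δ) := add_le_add this hmC
        _ = _ := by ring
    have hL' : (1 + α) * (1 - δ) * Real.logb 2 m ≤ (1 + δ) * Real.logb 2 n := by
      rw [div_le_iff₀ hδ0] at hlC
      rw [hβ', add_sub_cancel] at hL
      linarith
    have hδ1' : 0 < 1 - δ := by linarith
    have hL'' : (1 + α) * Real.logb 2 m ≤ (1 + δ) / (1 - δ) * Real.logb 2 n := by
      rw [div_mul_eq_mul_div, le_div_iff₀ hδ1']
      linarith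
    calc _ ≤ _ := hint
      _ ≤ Real.logb 2 m * ((1 + α) * (1 + δ) ^ 2 * m) := by gcongr
      _ = ((1 + α) * Real.logb 2 m) * ((1 + δ) ^ 2 * m) := by ring
      _ ≤ ((1 + δ) / (1 - δ) * Real.logb 2 n) * ((1 + δ) ^ 2 * m) := by gcongr
      _ = (1 + δ) ^ 3 / (1 - δ) * (m * Real.logb 2 n) := by ring
      _ ≤ _ := by gcongr
  · filter_upwards [hm.eventually (eventually_ge_atTop 0),
      hlog.eventually (eventually_ge_atTop 0)] with n h1 h2
    exact mul_nonneg h1 h2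

end PositiveIndex

end ETAC

theorem lemma6p3 (f : ℕ+ → ℝ) (hf : ETAC.IsEnvelope f)
    (F : ℝ → ℝ) (hF : ETAC.IsSmoothedEnvelope f F)
    (γ : ℝ) (hγ : 0 ≤ γ) (hmda : ETAC.InMDA F γ) :
    ETAC.EliasBound f (fun n => ∑ i ∈ Finset.Icc 1 n,
      1 / (i : ℝ) * (ETAC.exactThreshold F i * Real.logb 2 (ETAC.exactThreshold F i))) ∧
    ETAC.EliasBound f (fun n => ∫ t in (1 : ℝ)..(n : ℝ),
      1 / t * (ETAC.exactThreshold F t * Real.logb 2 (ETAC.exactThreshold F t))) ∧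
    ETAC.EliasBound f (fun n =>
      ETAC.exactThreshold F n * Real.logb 2 n * Real.logb 2 (ETAC.exactThreshold F n)) ∧
    (0 < γ → ETAC.EliasBound f (fun n =>
      ETAC.exactThreshold F n * Real.logb 2 n)) :=
  ⟨(ETAC.asympEliasBound_sum hf hF hγ hmda).eliasBound,
    (ETAC.asympEliasBound_integral hf hF hγ hmda).eliasBound,
    (ETAC.asympEliasBound_mul_logb hf hF hγ hmda).eliasBound,
    fun hγ' => (ETAC.asympEliasBound_mul_logb_of_pos hf hF hγ' hmda).eliasBound⟩
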